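/- **Conventions.** An *arrowed binary sequence* (ABS) $S=(\tilde S,\delta,\pi)$ is a finite totally ordered set $\tilde S$ with a map $\delta:\tilde S\to\{0,1\}$ and a bijection $\pi:\tilde S\to\tilde S$. Its *length* is $\ell(S)=\#\{(t',t)\mid \delta(t')=0,\ \delta(t)=1,\ t'<t\}$. The *binary expansion* of $t$ is $b(t)=0.b_1b_2\cdots$ with $b_k=\delta(\pi^{-k}(t))$; digit sequences are compared lexicographically. The *dual ABS* $S_D$ is $\tilde S$ with the reversed order, the symbols $0$ and $1$ exchanged, and the same $\pi$. For coprime non-negative integers $m,n$ and $h=m+n$, let $N_{m,n}$ be the ABS on $t_1<\cdots<t_h$ with $\delta(t_i)=1$ iff $i\le m$, and $\pi(t_i)=t_{i-m \bmod h}$. Let $(m_1,n_1)$ and $(m_2,n_2)$ be pairs of coprime non-negative integers, $h_r=m_r+n_r$, $\lambda_r=n_r/h_r$, with $\lambda_2<1/2<\lambda_1$. Let $A=N_{m_1,n_1}$, $B=N_{m_2,n_2}$, and let $S=A\oplus B=(\tilde S,\delta,\pi_0)$ be their disjoint union, ordered by binary expansion. For $\tau\in\{0,1\}$, $\tau^A_i$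 and $\tau^B_j$ denote the $i$-th element of $A$ and the $j$-th element of $B$, $\tau$ being its symbol. *Exchange.* Given $0^A_i$ and $1^B_j$ with $0^A_i<1^B_j$, let $\pi$ be the *small modification*: $\pi(\pi_0^{-1}(0^A_i))=1^B_j$, $\pi(\pi_0^{-1}(1^B_j))=0^A_i$, and $\pi=\pi_0$ elsewhere. The ABS $S'=S'(i,j)$ obtained by exchanging $0^A_i$ and $1^B_j$ is $\tilde S$ with $\delta$ and $\pi$, ordered by the binary expansions determined by $\delta$ and $\pi$. (Elements with equal expansions have equal symbols, so $\ell(S')$ does not depend on how ties are broken.) The exchange is *good* if $\ell(S')=\ell(S)-1$. *The sets $\mathcal A^{(n)}$ and $\mathcal B^{(n)}$.* Put $\alpha_n=\pi^n(0^A_i)$ and $\beta_n=\pi^n(1^B_j)$. Let $S^{(0)}$ be $\tilde S$ with the places of $0^A_i$ and $1^B_j$ in the order interchanged. Let $$\mathcal A^{(n)}=\{t\in A\mid t<\alpha_n,\ \alpha_{n+1}<\pi(t)\text{ in }S^{(n)},\ \delta(t)=\delta(\alpha_n)\}.$$ While $\mathcal A^{(n-1)}\neq\emptyset$, $S^{(n)}$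 is obtained from $S^{(n-1)}$ by moving $\alpha_n$ immediately to the right of $\pi(t_{\max})$, where $t_{\max}=\max\mathcal A^{(n-1)}$ in $S^{(n-1)}$. Let $a$ be the least number with $\mathcal A^{(a)}=\emptyset$; the construction of the $\mathcal A^{(n)}$ stops there. Next let $$\mathcal B^{(n)}=\{t\in \tilde S\mid \beta_n<t,\ \pi(t)<\beta_{n+1}\text{ in }S^{(a+n)},\ \delta(t)=\delta(\beta_n)\}.$$ While $\mathcal B^{(n-1)}\neq\emptyset$, $S^{(a+n)}$ is obtained from $S^{(a+n-1)}$ by moving $\beta_n$ immediately to the left of $\pi(t_{\min})$, where $t_{\min}=\min\mathcal B^{(n-1)}$ in $S^{(a+n-1)}$; the construction stops when $\mathcal B^{(n)}=\emptyset$. **Proposition.** (i) For $m_1<i\le n_1$ and $1\le j\le n_2$, $\ell(S')=\ell(S)-1$ if and only if there is no $n\ge 0$ such that $\mathcal A^{(n)}$ contains $0^A_{i+m_1}$ or $\mathcal B^{(n)}$ contains $0^B_{j+m_2}$. (ii) Assume $m_1>0$ or $n_2>0$. For $m_1<i\le n_1$ and $n_2<j\le m_2$, $\ell(S')<\ell(S)-1$.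 (iii) For $n_1<i\le h_1$ and $n_2<j\le m_2$, $\ell(S')=\ell(S)-1$ if and only if the dual ABS's satisfy $\ell(S'_D)=\ell(S_D)-1$. Equivalently, the exchange of $0^A_i$ and $1^B_j$ in $S$ is good if and only if the dual exchange, of the $(h_2-j+1)$-st element of the first summand and the $(h_1-i+1)$-st element of the second summand of $N_{n_2,m_2}\oplus N_{n_1,m_1}$, is good. -/

import Mathlib

/-- An arrowed binary sequence (ABS) on a set `T`: a total order on `T`, a map `δ : T → {0, 1}`
and a bijection `π : T → T`. The order is a field and not an instance, since one and the same set
carries many orders below. -/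
structure ABS (T : Type) where
  ord : LinearOrder T
  δ : T → Fin 2
  π : Equiv.Perm T

namespace ABS

noncomputable section

open Classical in
/-- The length `ℓ(S) = #{(t', t) | δ(t') = 0, δ(t) = 1, t' < t}`. -/
def length {T : Type} [Fintype T] (S : ABS T) : ℕ :=
  (Finset.univ.filter fun p : T × T =>
    S.δ p.1 = 0 ∧ S.δ p.2 = 1 ∧ S.ord.lt p.1 p.2).card

/-- The binary expansion `b(t) = 0.b₁b₂…` with `b_k = δ(π^{-k}(t))`, as the sequence of its digits
(`b_{k+1}` in position `k`); such sequences are compared lexicographically. -/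
def binExp {T : Type} (δ : T → Fin 2) (π : Equiv.Perm T) (t : T) : Lex (ℕ → Fin 2) :=
  toLex fun k => δ ((π⁻¹ ^ (k + 1)) t)

/-- The total order on `T` by increasing values of `b`; elements with the same value of `b` are
left in the order `o`. -/
@[reducible] def sortBy {T : Type} (o : LinearOrder T) (b : T → Lex (ℕ → Fin 2)) : LinearOrder T :=
  letI := o
  LinearOrder.lift' (fun t => (toLex (b t, t) : Lex (ℕ → Fin 2) ×ₗ T))
    (fun s t h => by simpa using congrArg (fun z => (ofLex z).2) h)

/-- The ABS of `N_{m,n}`: on `t_1 < ⋯ < t_h`, `h = m + n` (here `t_{k+1}` is `k : Fin (m + n)`),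
`δ(t_i) = 1` iff `i ≤ m`, and `π(t_i) = t_{i - m mod h}`; so `π` sends the first `m` elements to the
last `m` positions and the last `n` elements to the first `n` positions, preserving order. -/
def simple (m n : ℕ) : ABS (Fin (m + n)) where
  ord := inferInstance
  δ := fun k => if (k : ℕ) < m then 1 else 0
  π := finAddFlip.trans (finCongr (Nat.add_comm n m))

/-- The direct sum `A ⊕ B`: the disjoint union with `δ` and `π` taken from `A` and `B`, ordered by
binary expansion. Elements with the same expansion, if any, keep their order inside `A` and inside
`B`, those of `A` coming first. -/
def directSum {U V : Type} (A : ABS U) (B : ABS V) : ABS (U ⊕ V) :=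
  let δ : U ⊕ V → Fin 2 := Sum.elim A.δ B.δ
  let π : Equiv.Perm (U ⊕ V) := Equiv.sumCongr A.π B.π
  { ord := sortBy
      (letI := A.ord
       letI := B.ord
       LinearOrder.lift' (toLex : U ⊕ V → U ⊕ₗ V) toLex.injective)
      (binExp δ π)
    δ := δ
    π := π }

/-- The dual ABS. If `e_1, …, e_h` is a standard basis of a `DM₁` `N` with ABS `S`, then, since
transposition exchanges `F` and `V`, the dual basis in the reverse order is a standard basis of
the dual `N^D`: the order is reversed, `0` and `1` are exchanged, and `π` is the same map. -/
def dual {T : Type} (S : ABS T) : ABS T where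
  ord := letI := S.ord
    LinearOrder.lift' (OrderDual.toDual : T → Tᵒᵈ) OrderDual.toDual.injective
  δ := fun t => 1 - S.δ t
  π := S.π

/-- The small modification by `x` and `y` of `π₀`: `π(π₀⁻¹(x)) = y`, `π(π₀⁻¹(y)) = x`, and
`π(t) = π₀(t)` for the other `t`. -/
def smallMod {T : Type} [DecidableEq T] (π₀ : Equiv.Perm T) (x y : T) : Equiv.Perm T :=
  π₀.trans (Equiv.swap x y)

/-- The ABS `S' = (T, <', δ, π)` obtained from `S` by exchanging `x` and `y`: `π` is the small
modification, and `<'` orders `T` by the binary expansions determined by `δ` and `π`.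
If these expansions are pairwise distinct, `<'` is the unique order with `t <' t' → b(t) ≤ b(t')`,
and `δ(t) = δ(t')` implies `t <' t' ↔ π(t) <' π(t')` (`spec_ord_unique`, `spec_lt_iff_map_lt`).
Elements with the same expansion have the same symbol, so that the sequence of symbols along `<'`
and the length do not depend on how ties are broken (`length_eq_length_spec`). -/
def spec {T : Type} [DecidableEq T] (S : ABS T) (x y : T) : ABS T where
  ord := sortBy S.ord (binExp S.δ (smallMod S.π x y))
  δ := S.δ
  π := smallMod S.π x y

/-- `(S^{(0)}, δ, π)`: `π` is the small modification by `x` and `y`, and the two elements `x` and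
`y` change places in the order. -/
def initial {T : Type} [DecidableEq T] (S : ABS T) (x y : T) : ABS T where
  ord := letI := S.ord
    LinearOrder.lift' (Equiv.swap x y) (Equiv.swap x y).injective
  δ := S.δ
  π := smallMod S.π x y

/-- Move `u` to the place immediately to the right of `v`. -/
def moveRight {T : Type} [DecidableEq T] (S : ABS T) (u v : T) : ABS T where
  ord := letI := S.ord
    LinearOrder.lift'
      (fun t => (toLex (if t = u then (v, 1) else (t, 0)) : T ×ₗ Fin 2))
      (fun s t h => by
        have h' : (if s = u then (v, (1 : Fin 2)) else (s, 0)) = if t = u then (v, 1) else (t, 0) :=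
          h
        split_ifs at h' <;> simp_all)
  δ := S.δ
  π := S.π

/-- Move `u` to the place immediately to the left of `v`. -/
def moveLeft {T : Type} [DecidableEq T] (S : ABS T) (u v : T) : ABS T where
  ord := letI := S.ord
    LinearOrder.lift'
      (fun t => (toLex (if t = u then (v, 0) else (t, 1)) : T ×ₗ Fin 2))
      (fun s t h => by
        have h' : (if s = u then (v, (0 : Fin 2)) else (s, 1)) = if t = u then (v, 0) else (t, 1) :=
          h
        split_ifs at h' <;> simp_all)
  δ := S.δ
  π := S.π

open Classical in
/-- For an ABS `R` (in the role of `S^{(n)}`), a set `A` and `α` (in the role of `α_n`):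
`{t ∈ A | t < α, π(α) < π(t), δ(t) = δ(α)}`. -/
def setA {T : Type} [Fintype T] (R : ABS T) (A : Set T) (α : T) : Finset T :=
  Finset.univ.filter fun t =>
    t ∈ A ∧ R.ord.lt t α ∧ R.ord.lt (R.π α) (R.π t) ∧ R.δ t = R.δ α

open Classical in
/-- For an ABS `R` (in the role of `S^{(a+n)}`) and `β` (in the role of `β_n`):
`{t | β < t, π(t) < π(β), δ(t) = δ(β)}`. -/
def setB {T : Type} [Fintype T] (R : ABS T) (β : T) : Finset T :=
  Finset.univ.filter fun t =>
    R.ord.lt β t ∧ R.ord.lt (R.π t) (R.π β) ∧ R.δ t = R.δ β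

/-- The pairs `(S^{(n)}, 𝒜^{(n)})` for the small modification `π` of `S` by `x` and `y`, where `A` is
the set of elements of the first summand and `α_n = π^n(x)`: while `𝒜^{(n)}` is not empty, with
maximum `t_max` in `S^{(n)}`, move `α_{n+1}` to the right of `π(t_max)`. Once `𝒜^{(n)}` is empty,
the construction has stopped and nothing changes any more. -/
def stageA {T : Type} [Fintype T] [DecidableEq T] (S : ABS T) (A : Set T) (x y : T) :
    ℕ → ABS T × Finset T
  | 0 => (S.initial x y, (S.initial x y).setA A x)
  | n + 1 =>
    let R := (stageA S A x y n).1
    let E := (stageA S A x y n).2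
    let α := (R.π ^ (n + 1)) x
    if h : E.Nonempty then
      let R' := R.moveRight α (R.π (@Finset.max' T R.ord E h))
      (R', R'.setA A α)
    else (R, ∅)

/-- The smallest `a` with `𝒜^{(a)} = ∅`. -/
def stopA {T : Type} [Fintype T] [DecidableEq T] (S : ABS T) (A : Set T) (x y : T) : ℕ :=
  sInf {n | (stageA S A x y n).2 = ∅}

/-- The pairs `(S^{(a+n)}, ℬ^{(n)})`, where `a` is the smallest number with `𝒜^{(a)} = ∅` and
`β_n = π^n(y)`: while `ℬ^{(n)}` is not empty, with minimum `t_min` in `S^{(a+n)}`, move `β_{n+1}` to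
the left of `π(t_min)`. Once `ℬ^{(n)}` is empty, the construction has stopped. -/
def stageB {T : Type} [Fintype T] [DecidableEq T] (S : ABS T) (A : Set T) (x y : T) :
    ℕ → ABS T × Finset T
  | 0 =>
    let R := (stageA S A x y (stopA S A x y)).1
    (R, R.setB y)
  | n + 1 =>
    let R := (stageB S A x y n).1
    let E := (stageB S A x y n).2
    let β := (R.π ^ (n + 1)) y
    if h : E.Nonempty then
      let R' := R.moveLeft β (R.π (@Finset.min' T R.ord E h))
      (R', R'.setB β)
    else (R, ∅)

/-- The ABS `A ⊕ B` of the minimal `DM₁` `N_ξ`, `ξ = (m₁, n₁) + (m₂, n₂)`, where `A` and `B` are the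
ABS's of `N_{m₁,n₁}` and `N_{m₂,n₂}`. -/
def twoSegment (m₁ n₁ m₂ n₂ : ℕ) : ABS (Fin (m₁ + n₁) ⊕ Fin (m₂ + n₂)) :=
  directSum (simple m₁ n₁) (simple m₂ n₂)

/-- `symA i` is the `i`-th element `τ^A_i` of `A` (numbered from `1`) in the set of `A ⊕ B`. -/
def symA {h₁ h₂ : ℕ} (i : ℕ) (hi : 1 ≤ i ∧ i ≤ h₁) : Fin h₁ ⊕ Fin h₂ :=
  Sum.inl ⟨i - 1, by omega⟩

/-- `symB j` is the `j`-th element `τ^B_j` of `B` (numbered from `1`) in the set of `A ⊕ B`. -/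
def symB {h₁ h₂ : ℕ} (j : ℕ) (hj : 1 ≤ j ∧ j ≤ h₂) : Fin h₁ ⊕ Fin h₂ :=
  Sum.inr ⟨j - 1, by omega⟩

/-- The sets `𝒜^{(n)}` for the small modification by `x` and `y` of the `π₀` of `A ⊕ B`. -/
def calA (m₁ n₁ m₂ n₂ : ℕ) (x y : Fin (m₁ + n₁) ⊕ Fin (m₂ + n₂)) (n : ℕ) :
    Finset (Fin (m₁ + n₁) ⊕ Fin (m₂ + n₂)) :=
  (stageA (twoSegment m₁ n₁ m₂ n₂) (Set.range Sum.inl) x y n).2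

/-- The sets `ℬ^{(n)}` for the small modification by `x` and `y` of the `π₀` of `A ⊕ B`. -/
def calB (m₁ n₁ m₂ n₂ : ℕ) (x y : Fin (m₁ + n₁) ⊕ Fin (m₂ + n₂)) (n : ℕ) :
    Finset (Fin (m₁ + n₁) ⊕ Fin (m₂ + n₂)) :=
  (stageB (twoSegment m₁ n₁ m₂ n₂) (Set.range Sum.inl) x y n).2

end

/-! Facts showing that `spec` is what it should be. -/

theorem spec_lt_iff {T : Type} [DecidableEq T] (S : ABS T) (x y s t : T) :
    (S.spec x y).ord.lt s t ↔
      binExp S.δ (smallMod S.π x y) s < binExp S.δ (smallMod S.π x y) t ∨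
        binExp S.δ (smallMod S.π x y) s = binExp S.δ (smallMod S.π x y) t ∧ S.ord.lt s t := by
  let := S.ord
  exact Prod.Lex.lt_iff (x := (toLex (binExp S.δ (smallMod S.π x y) s, s)))
    (y := (toLex (binExp S.δ (smallMod S.π x y) t, t)))

theorem spec_ord_unique {T : Type} [DecidableEq T] (S : ABS T) (x y : T)
    (hb : Function.Injective (binExp S.δ (smallMod S.π x y))) (o : LinearOrder T)
    (ho : ∀ s t, o.lt s t →
      binExp S.δ (smallMod S.π x y) s ≤ binExp S.δ (smallMod S.π x y) t) (s t : T) :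
    o.lt s t ↔ (S.spec x y).ord.lt s t := by
  rw [spec_lt_iff]
  constructor
  · intro h
    rcases (ho s t h).lt_or_eq with h1 | h1
    · exact Or.inl h1
    · exact absurd (hb h1) (@ne_of_lt T o.toPreorder s t h)
  · rintro (h | ⟨h, h'⟩)
    · rcases @lt_trichotomy T o s t with h1 | h1 | h1
      · exact h1
      · subst h1; exact absurd h (lt_irrefl _)
      · exact absurd h (not_lt.mpr (ho t s h1))
    · exact absurd (hb h) (@ne_of_lt T S.ord.toPreorder s t h')

/-- The expansion of `π t` is the digit `δ t` followed by the expansion of `t`. -/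
theorem binExp_map_lt_iff {T : Type} (δ : T → Fin 2) (π : Equiv.Perm T) (s t : T)
    (h : δ s = δ t) : binExp δ π (π s) < binExp δ π (π t) ↔ binExp δ π s < binExp δ π t := by
  have e : ∀ (u : T) (k : ℕ), (π⁻¹ ^ (k + 1)) (π u) = (π⁻¹ ^ k) u := by
    intro u k
    rw [pow_succ, Equiv.Perm.mul_apply]
    simp
  change (∃ k, _) ↔ (∃ k, _)
  constructor
  · rintro ⟨k, h1, h2⟩
    cases k with
    | zero =>
      have h3 : δ ((π⁻¹ ^ (0 + 1)) (π s)) < δ ((π⁻¹ ^ (0 + 1)) (π t)) := h2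
      rw [e, e] at h3
      exact absurd h3 (by simp [h])
    | succ k =>
      refine ⟨k, fun j hj => ?_, ?_⟩
      · have h3 : δ ((π⁻¹ ^ (j + 1 + 1)) (π s)) = δ ((π⁻¹ ^ (j + 1 + 1)) (π t)) :=
          h1 (j + 1) (Nat.succ_lt_succ hj)
        rw [e, e] at h3
        exact h3
      · have h3 : δ ((π⁻¹ ^ (k + 1 + 1)) (π s)) < δ ((π⁻¹ ^ (k + 1 + 1)) (π t)) := h2
        rw [e, e] at h3
        exact h3
  · rintro ⟨k, h1, h2⟩
    refine ⟨k + 1, fun j hj => ?_, ?_⟩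
    · change δ ((π⁻¹ ^ (j + 1)) (π s)) = δ ((π⁻¹ ^ (j + 1)) (π t))
      rw [e, e]
      cases j with
      | zero => simpa using h
      | succ j => exact h1 j (Nat.lt_of_succ_lt_succ hj)
    · change δ ((π⁻¹ ^ (k + 1 + 1)) (π s)) < δ ((π⁻¹ ^ (k + 1 + 1)) (π t))
      rw [e, e]
      exact h2

theorem spec_lt_iff_map_lt {T : Type} [DecidableEq T] (S : ABS T) (x y : T)
    (hb : Function.Injective (binExp S.δ (smallMod S.π x y))) (s t : T) (h : S.δ s = S.δ t) :
    (S.spec x y).ord.lt s t ↔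
      (S.spec x y).ord.lt ((S.spec x y).π s) ((S.spec x y).π t) := by
  have key : ∀ u v, (S.spec x y).ord.lt u v ↔
      binExp S.δ (smallMod S.π x y) u < binExp S.δ (smallMod S.π x y) v := by
    intro u v
    rw [spec_lt_iff]
    refine ⟨?_, Or.inl⟩
    rintro (h | ⟨h, h'⟩)
    · exact h
    · exact absurd (hb h) (@ne_of_lt T S.ord.toPreorder u v h')
  rw [key, key]
  exact (binExp_map_lt_iff S.δ (smallMod S.π x y) s t h).symm

/-- Elements with the same expansion carry the same symbol. -/
theorem δ_eq_of_binExp_eq {T : Type} [Finite T] (δ : T → Fin 2) (π : Equiv.Perm T) (s t : T)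
    (h : binExp δ π s = binExp δ π t) : δ s = δ t := by
  obtain ⟨n, hn, hp⟩ := (isOfFinOrder_of_finite π⁻¹).exists_pow_eq_one
  obtain ⟨k, rfl⟩ : ∃ k, n = k + 1 := ⟨n - 1, by omega⟩
  have h1 : δ ((π⁻¹ ^ (k + 1)) s) = δ ((π⁻¹ ^ (k + 1)) t) := congrFun (congrArg ofLex h) k
  simpa [hp] using h1

/-- Every ordering by expansions gives the same length. -/
theorem length_eq_length_spec {T : Type} [Fintype T] [DecidableEq T] (S : ABS T) (x y : T)
    (R : ABS T) (hδ : R.δ = S.δ)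
    (hR : ∀ s t, R.ord.lt s t →
      binExp S.δ (smallMod S.π x y) s ≤ binExp S.δ (smallMod S.π x y) t) :
    R.length = (S.spec x y).length := by
  unfold length
  congr 1
  ext p
  simp only [Finset.mem_filter, Finset.mem_univ, true_and]
  rw [hδ]
  change (S.δ p.1 = 0 ∧ S.δ p.2 = 1 ∧ _) ↔ (S.δ p.1 = 0 ∧ S.δ p.2 = 1 ∧ _)
  refine and_congr_right fun h0 => and_congr_right fun h1 => ?_
  have hne : binExp S.δ (smallMod S.π x y) p.1 ≠ binExp S.δ (smallMod S.π x y) p.2 := by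
    intro h
    have := δ_eq_of_binExp_eq _ _ _ _ h
    rw [h0, h1] at this
    exact absurd this (by decide)
  rw [spec_lt_iff]
  constructor
  · intro h
    exact Or.inl (lt_of_le_of_ne (hR _ _ h) hne)
  · rintro (h | ⟨h, -⟩)
    · rcases @lt_trichotomy T R.ord p.1 p.2 with h2 | h2 | h2
      · exact h2
      · rw [h2] at h; exact absurd h (lt_irrefl _)
      · exact absurd h (not_lt.mpr (hR _ _ h2))
    · exact absurd h hne

end ABS

/-!
Compare two orders of the elements: the order `<'` of `S` with `x = 0^A_i` and `y = 1^B_j`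
interchanged, which loses one pair `0 < 1` for the pair `x`, `y` and one more for each element
between them, and the order by the expansions of the small modification `ψ`. For pairs of equal
symbols, `ψ` maps the pairs on which the order of `S` and the expansions disagree bijectively onto
the pairs on which `<'` and the expansions disagree. Counting these shows `ℓ(S') ≤ ℓ(S) - 1`, with
equality iff the expansions keep all pairs `0 < 1` of `<'` and restore the pairs of equal symbols
which the interchange has reversed.

In (i), each move repairs the images of the reversed pairs and passes the defect on along the
`ψ`-orbit of `x` or `y`. If the preimage `0^A_{i+m₁}` of `x`, resp. `0^B_{j+m₂}` of `y`, is never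
among the defects, the moves end with an order compatible with the symbols and with `ψ`, which
therefore agrees with the expansions. Otherwise going back along the orbit produces a pair
`0 < 1` of `<'`, or a reversed pair, which the expansions leave in the wrong order. In (ii)
following an element of `A` and one of `B` simultaneously always gives such a pair. Part (iii) holds
as passing to the dual reverses the order by expansions.
-/

namespace ABS

open Finset

section Count

variable {T L L' : Type} [LinearOrder L] [LinearOrder L']

open Classical in
/-- The number of pairs of a `0` and a `1` which `f` puts in the order `0 < 1`; for an injective
`f` this is the length of the sequence ordered by the values of `f`. -/
noncomputable def zeroOneCount [Fintype T] (δ : T → Fin 2) (f : T → L) : ℕ :=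
  #{p : T × T | δ p.1 = 0 ∧ δ p.2 = 1 ∧ f p.1 < f p.2}

theorem length_eq_zeroOneCount [Fintype T] (S : ABS T) (f : T → L)
    (hmono : ∀ s t, S.ord.lt s t → f s ≤ f t) (hδ : ∀ s t, f s = f t → S.δ s = S.δ t) :
    S.length = zeroOneCount S.δ f := by
  classical
  unfold length zeroOneCount
  refine congrArg card
    (filter_congr fun p _ => and_congr_right fun h0 => and_congr_right fun h1 => ?_)
  have hne : f p.1 ≠ f p.2 := fun h => by simpa [h0, h1] using hδ _ _ h
  refine ⟨fun h => (hmono _ _ h).lt_of_ne hne, fun h => ?_⟩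
  let := S.ord
  exact (lt_or_gt_of_ne (ne_of_apply_ne f hne)).resolve_right fun h' => (hmono _ _ h').not_gt h

open Classical in
/-- The pairs which `f` and `g` order differently. -/
noncomputable def inversions [Fintype T] (f : T → L) (g : T → L') : Finset (T × T) :=
  {p | f p.1 < f p.2 ∧ g p.2 < g p.1}

theorem mem_inversions [Fintype T] {f : T → L} {g : T → L'} {p : T × T} :
    p ∈ inversions f g ↔ f p.1 < f p.2 ∧ g p.2 < g p.1 := by
  simp [inversions]

open Classical in
theorem zeroOneCount_add_inversions [Fintype T] {δ : T → Fin 2} {f : T → L} {g : T → L'}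
    (hf : ∀ s t, f s = f t → δ s = δ t) (hg : ∀ s t, g s = g t → δ s = δ t) :
    zeroOneCount δ f + #{p ∈ inversions f g | δ p.1 = 1 ∧ δ p.2 = 0} =
      zeroOneCount δ g + #{p ∈ inversions f g | δ p.1 = 0 ∧ δ p.2 = 1} := by
  have hne {s t : T} (h0 : δ s = 0) (h1 : δ t = 1) : f s ≠ f t ∧ g s ≠ g t :=
    ⟨fun h => by simpa [h0, h1] using hf _ _ h, fun h => by simpa [h0, h1] using hg _ _ h⟩
  have hswap : #{p ∈ inversions f g | δ p.1 = 1 ∧ δ p.2 = 0} =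
      #{p : T × T | (δ p.1 = 0 ∧ δ p.2 = 1 ∧ g p.1 < g p.2) ∧ ¬ f p.1 < f p.2} := by
    refine card_bij' (fun p _ => p.swap) (fun p _ => p.swap) ?_ ?_ (by simp) (by simp)
    · simp +contextual [mem_inversions, le_of_lt]
    · simp +contextual only [mem_inversions, mem_filter, mem_univ, true_and, not_lt, Prod.fst_swap,
        Prod.snd_swap, and_true, and_imp, Prod.forall]
      exact fun s t h0 h1 _ h => h.lt_of_ne (hne h0 h1).1.symm
  have hkeep : #{p ∈ inversions f g | δ p.1 = 0 ∧ δ p.2 = 1} =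
      #{p : T × T | (δ p.1 = 0 ∧ δ p.2 = 1 ∧ f p.1 < f p.2) ∧ ¬ g p.1 < g p.2} := by
    refine congrArg card (Finset.ext fun p => ?_)
    simp only [mem_filter, mem_inversions, mem_univ, true_and, not_lt]
    exact ⟨fun h => ⟨⟨h.2.1, h.2.2, h.1.1⟩, h.1.2.le⟩,
      fun h => ⟨⟨h.1.2.2, h.2.lt_of_ne (hne h.1.1 h.1.2.1).2.symm⟩, h.1.1, h.1.2.1⟩⟩
  rw [hswap, hkeep, zeroOneCount, zeroOneCount,
    ← card_filter_add_card_filter_not (s := {p : T × T | δ p.1 = 0 ∧ δ p.2 = 1 ∧ f p.1 < f p.2})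
      (fun p => g p.1 < g p.2),
    ← card_filter_add_card_filter_not (s := {p : T × T | δ p.1 = 0 ∧ δ p.2 = 1 ∧ g p.1 < g p.2})
      (fun p => f p.1 < f p.2)]
  simp only [filter_filter]
  have : ∀ p : T × T, ((δ p.1 = 0 ∧ δ p.2 = 1 ∧ f p.1 < f p.2) ∧ g p.1 < g p.2) ↔
      ((δ p.1 = 0 ∧ δ p.2 = 1 ∧ g p.1 < g p.2) ∧ f p.1 < f p.2) := by tauto
  simp only [this]
  omega

open Classical in
theorem card_inversions_eq_add [Fintype T] (δ : T → Fin 2) (f : T → L) (g : T → L') :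
    #(inversions f g) = #{p ∈ inversions f g | δ p.1 = δ p.2} +
      #{p ∈ inversions f g | δ p.1 = 0 ∧ δ p.2 = 1} +
      #{p ∈ inversions f g | δ p.1 = 1 ∧ δ p.2 = 0} := by
  rw [← card_filter_add_card_filter_not (fun p : T × T => δ p.1 = δ p.2),
    ← card_filter_add_card_filter_not (s := {p ∈ inversions f g | ¬ δ p.1 = δ p.2})
      (fun p : T × T => δ p.1 = 0), filter_filter, filter_filter, add_assoc]
  congr 2 <;> refine congrArg card (filter_congr fun p _ => ?_) <;> omega

theorem binExp_map_lt_of_lt (δ : T → Fin 2) (π : Equiv.Perm T) {s t : T} (h : δ s < δ t) :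
    binExp δ π (π s) < binExp δ π (π t) :=
  ⟨0, fun _ h => absurd h (Nat.not_lt_zero _), by simpa [binExp] using h⟩

variable [DecidableEq T] {κ : T → L} {δ : T → Fin 2} {π : Equiv.Perm T} {x y s t z : T}

/-- The order by `κ` is compatible with `δ` and `π` in the way the order of `A ⊕ B` is: `π` keeps
the order of elements with the same symbol and puts images of `0`s before images of `1`s. -/
structure IsStable (κ : T → L) (δ : T → Fin 2) (π : Equiv.Perm T) : Prop where
  injective : Function.Injective κ
  map_lt_map : ∀ {s t}, δ s < δ t → κ (π s) < κ (π t)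
  map_lt_map_iff : ∀ {s t}, δ s = δ t → (κ (π s) < κ (π t) ↔ κ s < κ t)

/-- The exchange of `x` and `y` is as cheap as possible: ordering by expansions keeps each pair
`0 < 1` of the order `κ ∘ swap x y`, and restores each pair of equal symbols which `swap x y`
reverses. The pairs of the second kind consist of `x` or `y` and some `z` between the two. -/
structure IsGood (κ : T → L) (δ : T → Fin 2) (π : Equiv.Perm T) (x y : T) : Prop where
  zero_lt_one : ∀ {s t}, δ s = 0 → δ t = 1 → κ (Equiv.swap x y s) < κ (Equiv.swap x y t) →
    binExp δ (smallMod π x y) s < binExp δ (smallMod π x y) t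
  lt_left : ∀ {z}, κ z ∈ Set.Ioo (κ x) (κ y) → δ z = 0 →
    binExp δ (smallMod π x y) z < binExp δ (smallMod π x y) x
  right_lt : ∀ {z}, κ z ∈ Set.Ioo (κ x) (κ y) → δ z = 1 →
    binExp δ (smallMod π x y) y < binExp δ (smallMod π x y) z

theorem swap_smallMod (π : Equiv.Perm T) (x y t : T) :
    Equiv.swap x y (smallMod π x y t) = π t := by
  simp [smallMod]

theorem swap_apply_of_mem_Ioo (hz : κ z ∈ Set.Ioo (κ x) (κ y)) : Equiv.swap x y z = z :=
  Equiv.swap_apply_of_ne_of_ne (ne_of_apply_ne κ hz.1.ne') (ne_of_apply_ne κ hz.2.ne)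

theorem lt_swap_or_of_lt (hκ : κ.Injective) (hxy : κ x < κ y) (h : κ s < κ t) :
    κ (Equiv.swap x y s) < κ (Equiv.swap x y t) ∨ (s = x ∧ t = y) ∨
      (s = x ∧ κ t ∈ Set.Ioo (κ x) (κ y)) ∨ (t = y ∧ κ s ∈ Set.Ioo (κ x) (κ y)) := by
  have hne {u v : T} (h : u ≠ v) : κ u ≠ κ v := hκ.ne h
  simp only [Equiv.swap_apply_def, Set.mem_Ioo]
  grind

theorem lt_or_of_swap_lt (hκ : κ.Injective) (hxy : κ x < κ y)
    (h : κ (Equiv.swap x y s) < κ (Equiv.swap x y t)) :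
    κ s < κ t ∨ (s = y ∧ t = x) ∨
      (s = y ∧ κ t ∈ Set.Ioo (κ x) (κ y)) ∨ (t = x ∧ κ s ∈ Set.Ioo (κ x) (κ y)) := by
  have hne {u v : T} (h : u ≠ v) : κ u ≠ κ v := hκ.ne h
  simp only [Equiv.swap_apply_def, Set.mem_Ioo] at h ⊢
  grind

variable [Fintype T]

open Classical in
theorem zeroOneCount_swap (hκ : κ.Injective) (hxy : κ x < κ y) (hx : δ x = 0) (hy : δ y = 1) :
    zeroOneCount δ κ =
      zeroOneCount δ (κ ∘ Equiv.swap x y) + #{z | κ z ∈ Set.Ioo (κ x) (κ y)} + 1 := by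
  set Z : Finset T := {z | κ z ∈ Set.Ioo (κ x) (κ y)} with hZ
  let pair : T → T × T := fun z => if δ z = 0 then (z, y) else (x, z)
  have hkeep : ({p : T × T | (δ p.1 = 0 ∧ δ p.2 = 1 ∧ κ p.1 < κ p.2) ∧
      κ (Equiv.swap x y p.1) < κ (Equiv.swap x y p.2)} : Finset (T × T)) =
      ({p : T × T | δ p.1 = 0 ∧ δ p.2 = 1 ∧
        κ (Equiv.swap x y p.1) < κ (Equiv.swap x y p.2)} : Finset (T × T)) := by
    ext p
    have := lt_or_of_swap_lt (s := p.1) (t := p.2) hκ hxy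
    grind
  have hlost : ({p : T × T | (δ p.1 = 0 ∧ δ p.2 = 1 ∧ κ p.1 < κ p.2) ∧
      ¬ κ (Equiv.swap x y p.1) < κ (Equiv.swap x y p.2)} : Finset (T × T)) =
      insert (x, y) (Z.image pair) := by
    ext ⟨s, t⟩
    have := lt_swap_or_of_lt (s := s) (t := t) hκ hxy
    have hfix (z : T) := swap_apply_of_mem_Ioo (κ := κ) (x := x) (y := y) (z := z)
    have := Equiv.swap_apply_left x y
    have := Equiv.swap_apply_right x y
    simp only [mem_filter, mem_univ, true_and, mem_insert, mem_image, hZ, Set.mem_Ioo,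
      Prod.mk.injEq, pair] at *
    grind
  have hinj : Set.InjOn pair Z := by
    intro z hz z' hz' h
    simp only [hZ, coe_filter, mem_univ, true_and, Set.mem_Ioo, Set.mem_ofPred_eq, pair] at *
    grind
  have hnotin : (x, y) ∉ Z.image pair := by
    simp only [mem_filter, mem_univ, true_and, mem_image, hZ, Set.mem_Ioo, pair]
    grind
  rw [zeroOneCount, ← card_filter_add_card_filter_not
    (fun p : T × T => κ (Equiv.swap x y p.1) < κ (Equiv.swap x y p.2)), filter_filter,
    filter_filter, hkeep, hlost, card_insert_of_notMem hnotin, card_image_of_injOn hinj]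
  rfl

open Classical in
theorem card_inversions_of_isStable (hκ : IsStable κ δ π) :
    #(inversions (κ ∘ Equiv.swap x y) (binExp δ (smallMod π x y))) =
      #{p ∈ inversions κ (binExp δ (smallMod π x y)) | δ p.1 = δ p.2} := by
  set ψ := smallMod π x y
  have hk (t : T) : κ (Equiv.swap x y (ψ t)) = κ (π t) := congrArg κ (swap_smallMod π x y t)
  refine (card_bij' (fun p _ => (ψ p.1, ψ p.2)) (fun p _ => (ψ.symm p.1, ψ.symm p.2))
    ?_ ?_ (by simp) (by simp)).symm
  · rintro ⟨s, t⟩ h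
    simp only [mem_filter, mem_inversions, Function.comp_apply, hk] at h ⊢
    exact ⟨(hκ.map_lt_map_iff h.2).2 h.1.1, (binExp_map_lt_iff δ ψ t s h.2.symm).2 h.1.2⟩
  · rintro ⟨s, t⟩ h
    obtain ⟨s, rfl⟩ := ψ.surjective s
    obtain ⟨t, rfl⟩ := ψ.surjective t
    simp only [mem_inversions, Function.comp_apply, hk, mem_filter, Equiv.symm_apply_apply] at h ⊢
    have hδ : δ s = δ t := by
      by_contra hne
      rcases lt_or_gt_of_ne hne with hlt | hlt
      · exact h.2.not_gt (binExp_map_lt_of_lt δ ψ hlt)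
      · exact h.1.not_gt (hκ.map_lt_map hlt)
    exact ⟨⟨(hκ.map_lt_map_iff hδ).1 h.1, (binExp_map_lt_iff δ ψ t s hδ.symm).1 h.2⟩, hδ⟩

open Classical in
theorem card_inversions_le_add (hκ : κ.Injective) (hxy : κ x < κ y) (hx : δ x = 0)
    (hy : δ y = 1) (g : T → L') :
    #{p ∈ inversions κ g | δ p.1 = δ p.2} ≤
        #{p ∈ inversions (κ ∘ Equiv.swap x y) g | δ p.1 = δ p.2} +
          #{z | κ z ∈ Set.Ioo (κ x) (κ y)} ∧
      (#{p ∈ inversions κ g | δ p.1 = δ p.2} =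
        #{p ∈ inversions (κ ∘ Equiv.swap x y) g | δ p.1 = δ p.2} +
          #{z | κ z ∈ Set.Ioo (κ x) (κ y)} ↔
        ∀ z, κ z ∈ Set.Ioo (κ x) (κ y) → (δ z = 0 → g z < g x) ∧ (δ z = 1 → g y < g z)) := by
  set Z : Finset T := {z | κ z ∈ Set.Ioo (κ x) (κ y)} with hZ
  let pair : T → T × T := fun z => if δ z = 0 then (x, z) else (z, y)
  have hinj : Set.InjOn pair Z := by
    intro z hz z' hz' h
    simp only [hZ, coe_filter, mem_univ, true_and, Set.mem_Ioo, Set.mem_ofPred_eq, pair] at *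
    grind
  have hsub : {p ∈ inversions κ g | δ p.1 = δ p.2} ⊆
      {p ∈ inversions (κ ∘ Equiv.swap x y) g | δ p.1 = δ p.2} ∪ Z.image pair := by
    rintro ⟨s, t⟩
    have := lt_swap_or_of_lt (s := s) (t := t) hκ hxy
    simp only [mem_filter, mem_inversions, mem_univ, true_and, mem_union, mem_image, hZ,
      Function.comp_apply, pair] at *
    grind
  have hdisj : Disjoint {p ∈ inversions (κ ∘ Equiv.swap x y) g | δ p.1 = δ p.2} (Z.image pair) := by
    have hfix (z : T) := swap_apply_of_mem_Ioo (κ := κ) (x := x) (y := y) (z := z)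
    have := Equiv.swap_apply_left x y
    have := Equiv.swap_apply_right x y
    simp only [disjoint_left, mem_filter, mem_inversions, mem_univ, true_and, mem_image, hZ,
      Function.comp_apply, Set.mem_Ioo, pair] at *
    grind
  rw [← card_image_of_injOn hinj, ← card_union_of_disjoint hdisj]
  refine ⟨card_le_card hsub, fun h z hz => ?_, fun h => ?_⟩
  · have hmem : pair z ∈ ({p ∈ inversions κ g | δ p.1 = δ p.2} : Finset (T × T)) := by
      rw [eq_of_subset_of_card_le hsub h.ge]
      exact mem_union_right _ (mem_image_of_mem _ (by simpa [hZ] using hz))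
    simp only [mem_filter, mem_inversions, pair] at hmem
    grind
  · refine congrArg card (hsub.antisymm ?_)
    rintro ⟨s, t⟩
    have := lt_or_of_swap_lt (s := s) (t := t) hκ hxy
    simp only [mem_filter, mem_inversions, mem_univ, true_and, mem_union, mem_image, hZ,
      Function.comp_apply, Set.mem_Ioo, pair] at *
    grind

theorem zeroOneCount_exchange (hκ : IsStable κ δ π) (hxy : κ x < κ y) (hx : δ x = 0)
    (hy : δ y = 1) :
    zeroOneCount δ (binExp δ (smallMod π x y)) + 1 ≤ zeroOneCount δ κ ∧
      (zeroOneCount δ (binExp δ (smallMod π x y)) + 1 = zeroOneCount δ κ ↔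
        IsGood κ δ π x y) := by
  classical
  set b := binExp δ (smallMod π x y) with hb
  have hk : (κ ∘ Equiv.swap x y).Injective := hκ.injective.comp (Equiv.injective _)
  have hcount := zeroOneCount_add_inversions (f := κ ∘ Equiv.swap x y) (g := b) (δ := δ)
    (fun s t h => congrArg δ (hk h)) (fun s t => δ_eq_of_binExp_eq _ _ s t)
  have hswap := zeroOneCount_swap hκ.injective hxy hx hy
  have hinv := card_inversions_of_isStable (x := x) (y := y) hκ
  rw [← hb] at hinv
  have hsplit := card_inversions_eq_add δ (κ ∘ Equiv.swap x y) b
  obtain ⟨hle, hiff⟩ := card_inversions_le_add hκ.injective hxy hx hy b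
  have hgood : IsGood κ δ π x y ↔
      #{p ∈ inversions (κ ∘ Equiv.swap x y) b | δ p.1 = 0 ∧ δ p.2 = 1} = 0 ∧
        ∀ z, κ z ∈ Set.Ioo (κ x) (κ y) → (δ z = 0 → b z < b x) ∧ (δ z = 1 → b y < b z) := by
    rw [card_eq_zero, filter_eq_empty_iff]
    constructor
    · refine fun h => ⟨fun p hp hδ => ?_, fun z hz => ⟨h.lt_left hz, h.right_lt hz⟩⟩
      exact (mem_inversions.1 hp).2.not_gt (h.zero_lt_one hδ.1 hδ.2 (mem_inversions.1 hp).1)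
    · rintro ⟨h01, hZ⟩
      refine ⟨fun {s t} hs ht hlt => ?_, fun hz => (hZ _ hz).1, fun hz => (hZ _ hz).2⟩
      refine (lt_or_gt_of_ne fun h => ?_).resolve_right fun h =>
        h01 (mem_inversions (p := (s, t)).2 ⟨hlt, h⟩) ⟨hs, ht⟩
      simpa [hs, ht] using δ_eq_of_binExp_eq _ _ s t h
  refine ⟨by omega, Iff.trans ?_ ((and_congr_right' hiff).trans hgood.symm)⟩
  omega

end Count

section Comparison

variable {T : Type} {δ : T → Fin 2} {π : Equiv.Perm T} {s t : T}

theorem binExp_map_succ (δ : T → Fin 2) (π : Equiv.Perm T) (t : T) (k : ℕ) :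
    binExp δ π (π t) (k + 1) = binExp δ π t k :=
  congrArg δ (by rw [pow_succ, Equiv.Perm.mul_apply, π.inv_def, π.symm_apply_apply])

theorem binExp_map_eq [Finite T] (h : binExp δ π s = binExp δ π t) :
    binExp δ π (π s) = binExp δ π (π t) := by
  have hδ := δ_eq_of_binExp_eq δ π s t h
  refine le_antisymm (not_lt.1 fun hlt => ?_) (not_lt.1 fun hlt => ?_)
  · exact ((binExp_map_lt_iff δ π _ _ hδ.symm).1 hlt).ne' h
  · exact ((binExp_map_lt_iff δ π _ _ hδ).1 hlt).ne h

theorem rel_of_binExp_lt {r : T → T → Prop} (hlt : ∀ s t, δ s < δ t → r (π s) (π t))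
    (hmap : ∀ s t, δ s = δ t → r s t → r (π s) (π t)) (h : binExp δ π s < binExp δ π t) :
    r s t := by
  obtain ⟨k, hk, hlt_k⟩ : ∃ k, (∀ l < k, binExp δ π s l = binExp δ π t l) ∧
    binExp δ π s k < binExp δ π t k := h
  induction k generalizing s t with
  | zero => simpa using hlt _ _ hlt_k
  | succ k ih =>
    obtain ⟨s, rfl⟩ := π.surjective s
    obtain ⟨t, rfl⟩ := π.surjective t
    refine hmap s t (by simpa [binExp] using hk 0 k.succ_pos) (ih (fun l hl => ?_) ?_)
    · simpa only [binExp_map_succ] using hk (l + 1) (Nat.succ_lt_succ hl)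
    · simpa only [binExp_map_succ] using hlt_k

theorem binExp_congr [Finite T] (h : ∀ n, δ ((π ^ n) s) = δ ((π ^ n) t)) :
    binExp δ π s = binExp δ π t := by
  funext k
  obtain ⟨n, hn⟩ := (isOfFinOrder_of_finite π).mem_powers_iff_mem_zpowers.2
    (Subgroup.zpow_mem_zpowers π (-(k + 1 : ℕ)))
  have hpow : π⁻¹ ^ (k + 1) = π ^ n := by rw [inv_pow, ← zpow_natCast, ← zpow_neg]; exact hn.symm
  change δ ((π⁻¹ ^ (k + 1)) s) = δ ((π⁻¹ ^ (k + 1)) t)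
  rw [hpow, h n]

theorem binExp_pow_lt {n : ℕ} (h : ∀ r < n, δ ((π ^ r) s) = δ ((π ^ r) t)) :
    binExp δ π ((π ^ n) s) < binExp δ π ((π ^ n) t) ↔ binExp δ π s < binExp δ π t := by
  induction n with
  | zero => rfl
  | succ n ih =>
    rw [pow_succ', Equiv.Perm.mul_apply, Equiv.Perm.mul_apply,
      binExp_map_lt_iff _ _ _ _ (h n n.lt_succ_self), ih fun r hr => h r (hr.trans n.lt_succ_self)]

/-- Otherwise the images of `s` and `t` would have equal symbols for ever, so that `s` and `t` would
have equal expansions. -/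
theorem binExp_le_of_invariant [Finite T] (P : T → T → Prop)
    (hP : ∀ s t, P s t → binExp δ π t < binExp δ π s → δ s = δ t ∧ P (π s) (π t)) (h : P s t) :
    binExp δ π s ≤ binExp δ π t := by
  refine not_lt.1 fun hlt => ?_
  have hpow (n : ℕ) : P ((π ^ n) s) ((π ^ n) t) ∧
      binExp δ π ((π ^ n) t) < binExp δ π ((π ^ n) s) := by
    induction n with
    | zero => exact ⟨h, hlt⟩
    | succ n ih =>
      obtain ⟨hδ, hP'⟩ := hP _ _ ih.1 ih.2
      rw [pow_succ', Equiv.Perm.mul_apply, Equiv.Perm.mul_apply]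
      exact ⟨hP', (binExp_map_lt_iff _ _ _ _ hδ.symm).2 ih.2⟩
  exact hlt.ne' (binExp_congr fun n => (hP _ _ (hpow n).1 (hpow n).2).1)

variable {L : Type} [LinearOrder L] {κ : T → L} {x y : T}

theorem IsStable.swap_lt_swap [DecidableEq T] (hκ : IsStable κ δ π) (hδ : δ s = δ t)
    (h : κ s < κ t) :
    κ (Equiv.swap x y (smallMod π x y s)) < κ (Equiv.swap x y (smallMod π x y t)) := by
  rw [swap_smallMod, swap_smallMod]
  exact (hκ.map_lt_map_iff hδ).2 h

end Comparison

section TwoSegment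

variable {m n m₁ n₁ m₂ n₂ : ℕ}

theorem simple_π_val (k : Fin (m + n)) :
    ((simple m n).π k : ℕ) = if (k : ℕ) < m then k + n else k - m := by
  refine Fin.addCases (fun i => ?_) (fun i => ?_) k
  · simp [simple, Nat.add_comm]
  · simp [simple]

/-- Positions in `A ⊕ B` when `λ₂ < 1/2 < λ₁`: the images of the `0`s of `A`, the images of the
`0`s of `B`, the images of the `1`s of `A`, the images of the `1`s of `B`. -/
def pos (m₁ n₁ m₂ n₂ : ℕ) : Fin (m₁ + n₁) ⊕ Fin (m₂ + n₂) → ℕ :=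
  Sum.elim (fun a => if (a : ℕ) < n₁ then a else a + n₂)
    (fun b => if (b : ℕ) < n₂ then n₁ + b else m₁ + n₁ + b)

theorem pos_inl (a : Fin (m₁ + n₁)) :
    pos m₁ n₁ m₂ n₂ (.inl a) = if (a : ℕ) < n₁ then (a : ℕ) else a + n₂ := rfl

theorem pos_inr (b : Fin (m₂ + n₂)) :
    pos m₁ n₁ m₂ n₂ (.inr b) = if (b : ℕ) < n₂ then n₁ + (b : ℕ) else m₁ + n₁ + b := rfl

theorem twoSegment_δ_inl (a : Fin (m₁ + n₁)) :
    (twoSegment m₁ n₁ m₂ n₂).δ (.inl a) = if (a : ℕ) < m₁ then 1 else 0 := rfl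

theorem twoSegment_δ_inr (b : Fin (m₂ + n₂)) :
    (twoSegment m₁ n₁ m₂ n₂).δ (.inr b) = if (b : ℕ) < m₂ then 1 else 0 := rfl

theorem twoSegment_π_inl (a : Fin (m₁ + n₁)) :
    (twoSegment m₁ n₁ m₂ n₂).π (.inl a) = .inl ((simple m₁ n₁).π a) := rfl

theorem twoSegment_π_inr (b : Fin (m₂ + n₂)) :
    (twoSegment m₁ n₁ m₂ n₂).π (.inr b) = .inr ((simple m₂ n₂).π b) := rfl

theorem isStable_pos (h₁ : m₁ < n₁) (h₂ : n₂ < m₂) :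
    IsStable (pos m₁ n₁ m₂ n₂) (twoSegment m₁ n₁ m₂ n₂).δ (twoSegment m₁ n₁ m₂ n₂).π where
  injective := by
    rintro (a | b) (c | d) <;> simp only [pos_inl, pos_inr, Sum.inl.injEq, Sum.inr.injEq,
      Fin.ext_iff, reduceCtorEq] <;> grind
  map_lt_map := by
    rintro (a | b) (c | d) <;> simp only [twoSegment_δ_inl, twoSegment_δ_inr, twoSegment_π_inl,
      twoSegment_π_inr, pos_inl, pos_inr, simple_π_val] <;> grind
  map_lt_map_iff := by
    rintro (a | b) (c | d) <;> simp only [twoSegment_δ_inl, twoSegment_δ_inr, twoSegment_π_inl,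
      twoSegment_π_inr, pos_inl, pos_inr, simple_π_val] <;> grind

theorem sortBy_lt_iff {T : Type} (o : LinearOrder T) (b : T → Lex (ℕ → Fin 2)) (s t : T) :
    (sortBy o b).lt s t ↔ b s < b t ∨ b s = b t ∧ o.lt s t := by
  let := o
  exact Prod.Lex.lt_iff (x := (toLex (b s, s))) (y := (toLex (b t, t)))

theorem sortBy_le {T : Type} (o : LinearOrder T) (b : T → Lex (ℕ → Fin 2)) {s t : T}
    (h : (sortBy o b).lt s t) : b s ≤ b t :=
  ((sortBy_lt_iff o b s t).1 h).elim le_of_lt fun h => h.1.le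

theorem IsStable.lt_of_binExp_lt {T L : Type} [LinearOrder L] {κ : T → L} {δ : T → Fin 2}
    {π : Equiv.Perm T} (hκ : IsStable κ δ π) {s t : T} (h : binExp δ π s < binExp δ π t) :
    κ s < κ t :=
  rel_of_binExp_lt (r := fun s t => κ s < κ t) (fun _ _ => hκ.map_lt_map)
    (fun _ _ hδ => (hκ.map_lt_map_iff hδ).2) h

theorem toLex_lt_or_binExp_lt_of_pos_lt
    {s t : Fin (m₁ + n₁) ⊕ Fin (m₂ + n₂)} (h : pos m₁ n₁ m₂ n₂ s < pos m₁ n₁ m₂ n₂ t) :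
    toLex s < toLex t ∨
      binExp (twoSegment m₁ n₁ m₂ n₂).δ (twoSegment m₁ n₁ m₂ n₂).π s <
        binExp (twoSegment m₁ n₁ m₂ n₂).δ (twoSegment m₁ n₁ m₂ n₂).π t := by
  rcases s with a | b <;> rcases t with c | d
  · simp only [pos_inl] at h
    exact .inl (Sum.Lex.inl_lt_inl_iff.2 (by grind))
  · exact .inl (Sum.Lex.inl_lt_inr _ _)
  · right
    obtain ⟨s, hs⟩ := (twoSegment m₁ n₁ m₂ n₂).π.surjective (.inr b)
    obtain ⟨t, ht⟩ := (twoSegment m₁ n₁ m₂ n₂).π.surjective (.inl c)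
    rw [← hs, ← ht] at h ⊢
    refine binExp_map_lt_of_lt _ _ ?_
    rcases s with s | s <;> rcases t with t | t <;>
      simp only [twoSegment_π_inl, twoSegment_π_inr, reduceCtorEq] at hs ht
    simp only [twoSegment_δ_inl, twoSegment_δ_inr, twoSegment_π_inl, twoSegment_π_inr, pos_inl,
      pos_inr, simple_π_val] at h ⊢
    grind
  · simp only [pos_inr] at h
    exact .inl (Sum.Lex.inr_lt_inr_iff.2 (by grind))

theorem twoSegment_lt_iff (h₁ : m₁ < n₁) (h₂ : n₂ < m₂)
    (s t : Fin (m₁ + n₁) ⊕ Fin (m₂ + n₂)) :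
    (twoSegment m₁ n₁ m₂ n₂).ord.lt s t ↔ pos m₁ n₁ m₂ n₂ s < pos m₁ n₁ m₂ n₂ t := by
  have hκ := isStable_pos h₁ h₂
  have lt_of_pos_lt {s t} (h : pos m₁ n₁ m₂ n₂ s < pos m₁ n₁ m₂ n₂ t) :
      (twoSegment m₁ n₁ m₂ n₂).ord.lt s t := by
    refine (sortBy_lt_iff _ _ s t).2 ?_
    rcases (not_lt.1 fun h' => h.not_gt (hκ.lt_of_binExp_lt h')).lt_or_eq with hb | hb
    · exact .inl hb
    · exact .inr ⟨hb, (toLex_lt_or_binExp_lt_of_pos_lt h).resolve_right hb.not_lt⟩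
  refine ⟨fun h => ?_, lt_of_pos_lt⟩
  have hne : s ≠ t := @ne_of_lt _ (twoSegment m₁ n₁ m₂ n₂).ord.toPreorder s t h
  refine (lt_or_gt_of_ne (hκ.injective.ne hne)).resolve_right fun h' => ?_
  exact @lt_asymm _ (twoSegment m₁ n₁ m₂ n₂).ord.toPreorder s t h (lt_of_pos_lt h')

theorem length_spec {T : Type} [Fintype T] [DecidableEq T] (S : ABS T) (x y : T) :
    (S.spec x y).length = zeroOneCount S.δ (binExp S.δ (smallMod S.π x y)) :=
  length_eq_zeroOneCount (S.spec x y) _ (fun _ _ => sortBy_le _ _)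
    (fun _ _ => δ_eq_of_binExp_eq _ _ _ _)

theorem length_spec_twoSegment (h₁ : m₁ < n₁) (h₂ : n₂ < m₂)
    {x y : Fin (m₁ + n₁) ⊕ Fin (m₂ + n₂)} (hxy : pos m₁ n₁ m₂ n₂ x < pos m₁ n₁ m₂ n₂ y)
    (hx : (twoSegment m₁ n₁ m₂ n₂).δ x = 0) (hy : (twoSegment m₁ n₁ m₂ n₂).δ y = 1) :
    ((twoSegment m₁ n₁ m₂ n₂).spec x y).length + 1 ≤ (twoSegment m₁ n₁ m₂ n₂).length ∧
      (((twoSegment m₁ n₁ m₂ n₂).spec x y).length + 1 = (twoSegment m₁ n₁ m₂ n₂).length ↔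
        IsGood (pos m₁ n₁ m₂ n₂) (twoSegment m₁ n₁ m₂ n₂).δ (twoSegment m₁ n₁ m₂ n₂).π x y) := by
  have hκ := isStable_pos h₁ h₂
  rw [length_spec,
    length_eq_zeroOneCount _ (pos m₁ n₁ m₂ n₂) (fun s t h => ((twoSegment_lt_iff h₁ h₂ s t).1 h).le)
      (fun _ _ h => congrArg _ (hκ.injective h))]
  exact zeroOneCount_exchange hκ hxy hx hy

end TwoSegment

section Chase

variable {m₁ n₁ m₂ n₂ : ℕ} {i a : Fin (m₁ + n₁)} {j b : Fin (m₂ + n₂)}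

local notation "S" => twoSegment m₁ n₁ m₂ n₂
local notation "κ" => pos m₁ n₁ m₂ n₂
local notation "σ" => ABS.π (simple m₁ n₁)
local notation "τ" => ABS.π (simple m₂ n₂)
local notation "ψ" => smallMod (ABS.π (twoSegment m₁ n₁ m₂ n₂)) (Sum.inl i) (Sum.inr j)
local notation "𝔟" => binExp (ABS.δ (twoSegment m₁ n₁ m₂ n₂)) ψ

theorem smallMod_inl_of_ne (h : σ a ≠ i) : ψ (.inl a) = .inl (σ a) := by
  simp [smallMod, twoSegment_π_inl, Equiv.swap_apply_of_ne_of_ne, h]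

theorem smallMod_inr_of_ne (h : τ b ≠ j) : ψ (.inr b) = .inr (τ b) := by
  simp [smallMod, twoSegment_π_inr, Equiv.swap_apply_of_ne_of_ne, h]

theorem smallMod_inl_of_eq (h : σ a = i) : ψ (.inl a) = .inr j := by
  simp [smallMod, twoSegment_π_inl, h]

theorem smallMod_inr_of_eq (h : τ b = j) : ψ (.inr b) = .inl i := by
  simp [smallMod, twoSegment_π_inr, h]

/-- The element of `A` and the element of `B` are followed simultaneously; as soon as their symbols
differ, they are `0` and `1`, and `IsGood.zero_lt_one` applies. -/
theorem IsGood.binExp_inl_le_inr (hG : IsGood κ (S).δ (S).π (.inl i) (.inr j))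
    (hκ : IsStable κ (S).δ (S).π) (Q : Fin (m₁ + n₁) → Fin (m₂ + n₂) → Prop)
    (hδ : ∀ a b, Q a b → (S).δ (.inl a) ≤ (S).δ (.inr b))
    (hstep : ∀ a b, κ (.inl a) < κ (.inr b) → Q a b → (S).δ (.inl a) = (S).δ (.inr b) →
      𝔟 (ψ (.inl a)) ≤ 𝔟 (ψ (.inr b)) ∨ σ a ≠ i ∧ τ b ≠ j ∧ Q (σ a) (τ b))
    (hpos : κ (.inl a) < κ (.inr b))
    (hswap : κ (Equiv.swap (.inl i) (.inr j) (.inl a)) <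
      κ (Equiv.swap (.inl i) (.inr j) (.inr b))) (hQ : Q a b) :
    𝔟 (.inl a) ≤ 𝔟 (.inr b) := by
  let P (s t : Fin (m₁ + n₁) ⊕ Fin (m₂ + n₂)) : Prop := ∃ a b, s = .inl a ∧ t = .inr b ∧
    κ s < κ t ∧ κ (Equiv.swap (.inl i) (.inr j) s) < κ (Equiv.swap (.inl i) (.inr j) t) ∧ Q a b
  refine binExp_le_of_invariant P ?_ ⟨a, b, rfl, rfl, hpos, hswap, hQ⟩
  rintro _ _ ⟨a, b, rfl, rfl, hpos, hswap, hQ⟩ hlt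
  have heq : (S).δ (.inl a) = (S).δ (.inr b) := by
    refine (hδ a b hQ).eq_of_not_lt fun h => hlt.not_gt (hG.zero_lt_one ?_ ?_ hswap) <;> omega
  refine ⟨heq, ?_⟩
  rcases hstep a b hpos hQ heq with hle | ⟨ha, hb, hQ'⟩
  · exact absurd ((binExp_map_lt_iff _ _ _ _ heq.symm).2 hlt) hle.not_gt
  · have hswap' := hκ.swap_lt_swap (x := .inl i) (y := .inr j) heq hpos
    rw [smallMod_inl_of_ne ha, smallMod_inr_of_ne hb] at hswap' ⊢
    refine ⟨σ a, τ b, rfl, rfl, ?_, hswap', hQ'⟩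
    exact (hκ.map_lt_map_iff heq).2 hpos

theorem IsGood.binExp_inl_lt (hG : IsGood κ (S).δ (S).π (.inl i) (.inr j)) (hi : m₁ ≤ (i : ℕ))
    (hia : i < a) (haj : κ (.inl a) < κ (.inr j)) : 𝔟 (.inl a) < 𝔟 (.inl i) := by
  refine hG.lt_left ⟨?_, haj⟩ ?_
  · rw [pos_inl, pos_inl]; grind
  · rw [twoSegment_δ_inl]; grind

theorem IsGood.binExp_inr_lt (hG : IsGood κ (S).δ (S).π (.inl i) (.inr j)) (hj : (j : ℕ) < m₂)
    (hbj : b < j) (hib : κ (.inl i) < κ (.inr b)) : 𝔟 (.inr j) < 𝔟 (.inr b) := by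
  refine hG.right_lt ⟨hib, ?_⟩ ?_
  · rw [pos_inr, pos_inr]; grind
  · rw [twoSegment_δ_inr]; grind

theorem IsGood.binExp_inl_le_inr_of_le (hG : IsGood κ (S).δ (S).π (.inl i) (.inr j))
    (h₁ : m₁ < n₁) (h₂ : n₂ < m₂) (hi : m₁ ≤ (i : ℕ) ∧ (i : ℕ) < n₁)
    (hj : n₂ ≤ (j : ℕ) ∧ (j : ℕ) < m₂) (hpos : κ (.inl a) < κ (.inr b))
    (hswap : κ (Equiv.swap (.inl i) (.inr j) (.inl a)) <
      κ (Equiv.swap (.inl i) (.inr j) (.inr b)))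
    (hab : (a : ℕ) < n₁ ∧ (b : ℕ) < m₂ ∨ m₁ ≤ (a : ℕ) ∧ n₂ ≤ (b : ℕ)) :
    𝔟 (.inl a) ≤ 𝔟 (.inr b) := by
  refine hG.binExp_inl_le_inr (isStable_pos h₁ h₂) (fun a b : Fin _ =>
    (a : ℕ) < n₁ ∧ (b : ℕ) < m₂ ∨ m₁ ≤ (a : ℕ) ∧ n₂ ≤ (b : ℕ)) (fun a b hQ => ?_)
    (fun a b _ hQ hδ => ?_) hpos hswap hab
  · rw [twoSegment_δ_inl, twoSegment_δ_inr]; grind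
  have hσ := simple_π_val a
  have hτ := simple_π_val b
  simp only [twoSegment_δ_inl, twoSegment_δ_inr] at hδ
  rcases hQ with hQ | hQ
  · by_cases hb : τ b = j
    · left
      rw [smallMod_inl_of_ne (by grind), smallMod_inr_of_eq hb]
      exact (hG.binExp_inl_lt hi.1 (by grind) (by rw [pos_inl, pos_inr]; grind)).le
    · exact .inr ⟨by grind, hb, by grind⟩
  · by_cases ha : σ a = i
    · left
      rw [smallMod_inl_of_eq ha, smallMod_inr_of_ne (by grind)]
      exact (hG.binExp_inr_lt hj.2 (by grind) (by rw [pos_inl, pos_inr]; grind)).le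
    · exact .inr ⟨ha, by grind, by grind⟩

theorem not_isGood_of_le (h₁ : m₁ < n₁) (h₂ : n₂ < m₂) (hpos : 0 < m₁ ∨ 0 < n₂)
    (hi : m₁ ≤ (i : ℕ) ∧ (i : ℕ) < n₁) (hj : n₂ ≤ (j : ℕ) ∧ (j : ℕ) < m₂) :
    ¬ IsGood κ (S).δ (S).π (.inl i) (.inr j) := by
  intro hG
  have hle {a b} := hG.binExp_inl_le_inr_of_le (a := a) (b := b) h₁ h₂ hi hj
  have hσ := simple_π_val i
  have hτ := simple_π_val j
  rcases hpos with hm | hn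
  · let w : Fin (m₁ + n₁) := ⟨i + m₁, by omega⟩
    have hw : σ w = i := Fin.ext (by rw [simple_π_val]; grind)
    have hlt : 𝔟 (ψ (.inl w)) < 𝔟 (ψ (.inl i)) := by
      refine (binExp_map_lt_iff _ _ _ _ ?_).2 (hG.binExp_inl_lt hi.1 (by grind) ?_)
      · simp only [twoSegment_δ_inl]; grind
      · rw [pos_inl, pos_inr]; grind
    rw [smallMod_inl_of_eq hw, smallMod_inl_of_ne (by grind)] at hlt
    refine (hle ?_ ?_ (.inl ?_)).not_gt hlt
    · rw [pos_inl, pos_inr]; grind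
    · rw [Equiv.swap_apply_of_ne_of_ne (by grind) (by grind), Equiv.swap_apply_right, pos_inl,
        pos_inl]
      grind
    · grind
  · let v : Fin (m₂ + n₂) := ⟨j - n₂, by omega⟩
    have hv : τ v = j := Fin.ext (by rw [simple_π_val]; grind)
    have hlt : 𝔟 (ψ (.inr j)) < 𝔟 (ψ (.inr v)) := by
      refine (binExp_map_lt_iff _ _ _ _ ?_).2 (hG.binExp_inr_lt hj.2 (by grind) ?_)
      · simp only [twoSegment_δ_inr]; grind
      · rw [pos_inl, pos_inr]; grind
    rw [smallMod_inr_of_eq hv, smallMod_inr_of_ne (by grind)] at hlt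
    refine (hle ?_ ?_ (.inr ?_)).not_gt hlt
    · rw [pos_inl, pos_inr]; grind
    · rw [Equiv.swap_apply_left, Equiv.swap_apply_of_ne_of_ne (by grind) (by grind), pos_inr,
        pos_inr]
      grind
    · grind

end Chase

section MoveProcess

variable {T : Type} {δ : T → Fin 2} {π : Equiv.Perm T} {s t u : T}

/-- A pair of equal symbols in the order `r` whose images are in the opposite order. -/
def IsReversed (δ : T → Fin 2) (π : Equiv.Perm T) (r : T → T → Prop) (s t : T) : Prop :=
  δ s = δ t ∧ r s t ∧ r (π t) (π s)

theorem rel_map_of_not_isReversed {r : T → T → Prop} [IsStrictTotalOrder T r] (hδ : δ s = δ t)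
    (hrev : ¬ IsReversed δ π r s t) (h : r s t) : r (π s) (π t) := by
  rcases trichotomous_of r (π s) (π t) with h' | h' | h'
  · exact h'
  · exact absurd (π.injective h' ▸ h) (irrefl t)
  · exact absurd ⟨hδ, h, h'⟩ hrev

/-- The common form of the constructions of the `𝒜^{(n)}` and of the `ℬ^{(n)}`: `r n` is the order
of `S^{(n)}` in the first case and the opposite of the order of `S^{(a+n)}` in the second, and `E n`
is `𝒜^{(n)}` or `ℬ^{(n)}`. -/
structure IsMoveProcess (δ : T → Fin 2) (π : Equiv.Perm T) (C : Set T) (x : T)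
    (r : ℕ → T → T → Prop) (E : ℕ → Finset T) : Prop where
  isStrictTotalOrder : ∀ n, IsStrictTotalOrder T (r n)
  mem_iff : ∀ {n t}, (∀ k < n, (E k).Nonempty) →
    (t ∈ E n ↔ t ∈ C ∧ IsReversed δ π (r n) t ((π ^ n) x))
  eq_empty_succ : ∀ {n}, E n = ∅ → E (n + 1) = ∅
  exists_max : ∀ {n}, (E n).Nonempty → ∃ u ∈ E n, (∀ t ∈ E n, t = u ∨ r n t u) ∧
    (∀ {s t}, s ≠ (π ^ (n + 1)) x → t ≠ (π ^ (n + 1)) x → (r (n + 1) s t ↔ r n s t)) ∧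
    ∀ {s}, s ≠ (π ^ (n + 1)) x → (r (n + 1) s ((π ^ (n + 1)) x) ↔ s = π u ∨ r n s (π u))

namespace IsMoveProcess

/-- The state of a move process after `n` moves. The moves concern the elements of `D`; the pairs
in `F` are reversed throughout. -/
structure Invariant (δ : T → Fin 2) (π : Equiv.Perm T) (c : Fin 2) (D : Set T)
    (F : T → T → Prop) (x : T) (r : ℕ → T → T → Prop) (E : ℕ → Finset T) (n : ℕ) : Prop where
  map_rel_map : ∀ {s t}, δ s = c → δ t ≠ c → r n (π s) (π t)
  cases_of_isReversed : ∀ {s t}, IsReversed δ π (r n) s t → t = (π ^ n) x ∧ s ∈ D ∨ F s t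
  exists_origin : ∀ {u}, u ∈ E n → ∃ z, (π ^ n) z = u ∧ ∀ k ≤ n, (π ^ k) z ∈ E k

variable {C D : Set T} {x : T} {r : ℕ → T → T → Prop} {E : ℕ → Finset T} {c : Fin 2}
  {F : T → T → Prop} {n : ℕ}

theorem nonempty_of_le (hM : IsMoveProcess δ π C x r E) {k : ℕ} (hk : k ≤ n)
    (h : (E n).Nonempty) : (E k).Nonempty := by
  induction n, hk using Nat.le_induction with
  | base => exact h
  | succ n _ ih =>
    exact ih (nonempty_iff_ne_empty.2 fun he => h.ne_empty (hM.eq_empty_succ he))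

theorem isReversed_of_mem (hM : IsMoveProcess δ π C x r E) (h : t ∈ E n) :
    t ∈ C ∧ IsReversed δ π (r n) t ((π ^ n) x) :=
  (hM.mem_iff fun _ hk => hM.nonempty_of_le hk.le ⟨t, h⟩).1 h

theorem mem_of_mem (hM : IsMoveProcess δ π C x r E) (hI : Invariant δ π c D F x r E n)
    (hF : ∀ s t, F s t → t ∉ D) (hα : (π ^ n) x ∈ D) (h : t ∈ E n) : t ∈ D :=
  (hI.cases_of_isReversed (hM.isReversed_of_mem h).2).elim And.right fun h => absurd hα (hF _ _ h)

theorem map_rel_map_of_mem (hM : IsMoveProcess δ π C x r E) (hI : Invariant δ π c D F x r E n)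
    (hF : ∀ s t, F s t → t ∉ D) (hα : (π ^ n) x ∈ D) (hs : s ∈ E n) (ht : t ∈ E n)
    (h : r n s t) : r n (π s) (π t) := by
  have := hM.isStrictTotalOrder n
  have hδs := (hM.isReversed_of_mem hs).2.1
  have ⟨hδt, hlt, _⟩ := (hM.isReversed_of_mem ht).2
  refine rel_map_of_not_isReversed (hδs.trans hδt.symm) (fun hrev => ?_) h
  rcases hI.cases_of_isReversed hrev with ⟨rfl, _⟩ | hst
  · exact irrefl _ hlt
  · exact hF _ _ hst (hM.mem_of_mem hI hF hα ht)

theorem mem_of_map_between (hM : IsMoveProcess δ π C x r E) (hI : Invariant δ π c D F x r E n)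
    (hDC : D ⊆ C) (hF : ∀ s t, F s t → s ∉ D ∧ t ∉ D) (hα : (π ^ n) x ∈ D) (hu : u ∈ E n)
    (hαt : r n (π ((π ^ n) x)) (π t)) (htu : r n (π t) (π u)) : t ∈ E n := by
  have := hM.isStrictTotalOrder n
  obtain ⟨hδu, hu_lt, _⟩ := (hM.isReversed_of_mem hu).2
  have hδ : δ t = δ ((π ^ n) x) := by
    by_contra hne
    by_cases hc : δ t = c
    · exact asymm hαt (hI.map_rel_map hc (by grind))
    · exact asymm htu (hI.map_rel_map (by omega) hc)
  rcases trichotomous_of (r n) t ((π ^ n) x) with hlt | rfl | hlt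
  · refine (hM.mem_iff fun k hk => hM.nonempty_of_le hk.le ⟨u, hu⟩).2 ⟨?_, hδ, hlt, hαt⟩
    rcases hI.cases_of_isReversed ⟨hδ, hlt, hαt⟩ with h | h
    · exact hDC h.2
    · exact absurd hα (hF _ _ h).2
  · exact absurd hαt (irrefl _)
  · rcases hI.cases_of_isReversed ⟨hδu.trans hδ.symm, _root_.trans hu_lt hlt, htu⟩ with h | h
    · exact absurd (h.1 ▸ hlt) (irrefl _)
    · exact absurd (hM.mem_of_mem hI (fun s t h => (hF s t h).2) hα hu) (hF _ _ h).1

theorem rel_succ_self_iff (hM : IsMoveProcess δ π C x r E) (hI : Invariant δ π c D F x r E n)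
    (hDC : D ⊆ C) (hF : ∀ s t, F s t → s ∉ D ∧ t ∉ D) (hα : (π ^ n) x ∈ D) (hE : (E n).Nonempty)
    (hs : s ≠ (π ^ (n + 1)) x) :
    r (n + 1) s ((π ^ (n + 1)) x) ↔ r n s ((π ^ (n + 1)) x) ∨ ∃ u ∈ E n, π u = s := by
  have := hM.isStrictTotalOrder n
  obtain ⟨u, hu, hmax, -, hself⟩ := hM.exists_max hE
  have hsucc : (π ^ (n + 1)) x = π ((π ^ n) x) := by rw [pow_succ', Equiv.Perm.mul_apply]
  rw [hself hs, hsucc]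
  constructor
  · rintro (rfl | h)
    · exact .inr ⟨u, hu, rfl⟩
    · obtain ⟨t, rfl⟩ := π.surjective s
      rcases trichotomous_of (r n) (π t) (π ((π ^ n) x)) with h' | h' | h'
      · exact .inl h'
      · exact absurd (h'.trans hsucc.symm) hs
      · exact .inr ⟨t, hM.mem_of_map_between hI hDC hF hα hu h' h, rfl⟩
  · rintro (h | ⟨t, ht, rfl⟩)
    · exact .inr (_root_.trans h (hM.isReversed_of_mem hu).2.2.2)
    · exact (hmax t ht).imp (congrArg π)
        (hM.map_rel_map_of_mem hI (fun s t h => (hF s t h).2) hα ht hu)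

theorem rel_succ_iff (hM : IsMoveProcess δ π C x r E) (hI : Invariant δ π c D F x r E n)
    (hDC : D ⊆ C) (hF : ∀ s t, F s t → s ∉ D ∧ t ∉ D) (hα : (π ^ n) x ∈ D) (hE : (E n).Nonempty)
    (s t : T) : r (n + 1) s t ↔
      r n s t ∧ ¬ (s = (π ^ (n + 1)) x ∧ ∃ u ∈ E n, π u = t) ∨
        t = (π ^ (n + 1)) x ∧ ∃ u ∈ E n, π u = s := by
  have ho := hM.isStrictTotalOrder n
  have ho' := hM.isStrictTotalOrder (n + 1)
  obtain ⟨u, _, -, hne, -⟩ := hM.exists_max hE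
  have hself {s} := hM.rel_succ_self_iff (s := s) hI hDC hF hα hE
  have hrev : ∀ v ∈ E n, r n ((π ^ (n + 1)) x) (π v) := fun v hv => by
    rw [pow_succ', Equiv.Perm.mul_apply]
    exact (hM.isReversed_of_mem hv).2.2.2
  by_cases hs : s = (π ^ (n + 1)) x <;> by_cases ht : t = (π ^ (n + 1)) x
  · have := irrefl (r := r n) s
    have := irrefl (r := r (n + 1)) s
    grind
  · have := trichotomous_of (r n) s t
    have := trichotomous_of (r (n + 1)) s t
    have := asymm_of (r n) (a := s) (b := t)
    have := asymm_of (r (n + 1)) (a := s) (b := t)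
    grind
  · grind
  · grind

theorem cases_of_isReversed_succ (hM : IsMoveProcess δ π C x r E)
    (hI : Invariant δ π c D F x r E n) (hDC : D ⊆ C) (hF : ∀ s t, F s t → s ∉ D ∧ t ∉ D)
    (hα : (π ^ n) x ∈ D) (hE : (E n).Nonempty) (h : IsReversed δ π (r (n + 1)) s t) :
    (t = (π ^ (n + 1)) x ∧ ∃ u ∈ E n, π u = s) ∨ F s t := by
  have := hM.isStrictTotalOrder n
  obtain ⟨hδ, hst, hts⟩ := h
  simp only [hM.rel_succ_iff hI hDC hF hα hE, pow_succ', Equiv.Perm.mul_apply, π.injective.eq_iff,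
    exists_eq_right] at hst hts ⊢
  rcases hst with ⟨hst, -⟩ | hst
  · rcases hts with ⟨hts, hnot⟩ | ⟨rfl, ht⟩
    · refine .inr ((hI.cases_of_isReversed ⟨hδ, hst, hts⟩).resolve_left fun ⟨ht, hs⟩ => ?_)
      refine hnot ⟨ht, (hM.mem_iff fun k hk => hM.nonempty_of_le hk.le hE).2 ⟨hDC hs, ?_⟩⟩
      exact ht ▸ ⟨hδ, hst, hts⟩
    · exact absurd (hM.isReversed_of_mem ht).2.2.1 (asymm hst)
  · exact .inl hst

theorem Invariant.succ (hM : IsMoveProcess δ π C x r E) (hI : Invariant δ π c D F x r E n)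
    (hDC : D ⊆ C) (hF : ∀ s t, F s t → s ∉ D ∧ t ∉ D) (hα : (π ^ n) x ∈ D)
    (hα' : (π ^ (n + 1)) x ∈ D) (hED : ∀ u ∈ E n, π u ∈ D) (hE : (E n).Nonempty) :
    Invariant δ π c D F x r E (n + 1) where
  map_rel_map {s t} hs ht := by
    refine (hM.rel_succ_iff hI hDC hF hα hE _ _).2 (.inl ⟨hI.map_rel_map hs ht, ?_⟩)
    rintro ⟨hsα, u, hu, hut⟩
    rw [pow_succ', Equiv.Perm.mul_apply, π.injective.eq_iff] at hsα
    exact ht (by rw [← π.injective hut, (hM.isReversed_of_mem hu).2.1, ← hsα, hs])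
  cases_of_isReversed h := by
    rcases hM.cases_of_isReversed_succ hI hDC hF hα hE h with ⟨ht, u, hu, rfl⟩ | hst
    · exact .inl ⟨ht, hED u hu⟩
    · exact .inr hst
  exists_origin {u} hu := by
    have hrev := hM.isReversed_of_mem hu
    rcases hM.cases_of_isReversed_succ hI hDC hF hα hE hrev.2 with ⟨-, v, hv, rfl⟩ | h
    · obtain ⟨z, rfl, hz⟩ := hI.exists_origin hv
      rw [← Equiv.Perm.mul_apply, ← pow_succ'] at hu ⊢
      exact ⟨z, rfl, fun k hk => (Nat.le_succ_iff.1 hk).elim (hz k) fun h => h ▸ hu⟩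
    · exact absurd hα' (hF _ _ h).2

end IsMoveProcess

open IsMoveProcess

/-- A move process whose moves take place on the arc `D = {x, π x, …, π ^ L x}`, which is in `C`. At
the start the reversed pairs are those of `F`, which avoid `D`, and pairs `s`, `x` with `s ∈ D`. -/
structure IsArcProcess (δ : T → Fin 2) (π : Equiv.Perm T) (c : Fin 2) (C D : Set T)
    (F : T → T → Prop) (x : T) (L : ℕ) (r : ℕ → T → T → Prop) (E : ℕ → Finset T) : Prop extends
    IsMoveProcess δ π C x r E where
  invariant_zero : Invariant δ π c D F x r E 0
  subset : D ⊆ C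
  notMem : ∀ s t, F s t → s ∉ D ∧ t ∉ D
  bijOn : Set.BijOn (fun k => (π ^ k) x) (Set.Iic L) D

namespace IsArcProcess

variable {C D : Set T} {x : T} {r : ℕ → T → T → Prop} {E : ℕ → Finset T} {c : Fin 2}
  {F : T → T → Prop} {n L : ℕ}

theorem exists_pow_eq_of_mem (hP : IsArcProcess δ π c C D F x L r E)
    (hI : Invariant δ π c D F x r E n) (hn : n ≤ L) (hu : u ∈ E n) : ∃ q ≤ L, (π ^ q) x = u :=
  hP.bijOn.surjOn (hP.mem_of_mem hI (fun s t h => (hP.notMem s t h).2) (hP.bijOn.mapsTo hn) hu)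

theorem lt_of_nonempty (hP : IsArcProcess δ π c C D F x L r E)
    (hI : Invariant δ π c D F x r E n) (hw : ∀ k < n, (π ^ L) x ∉ E k)
    (hE : (E n).Nonempty) : n < L := by
  obtain ⟨u, hu⟩ := hE
  obtain ⟨z, -, hz⟩ := hI.exists_origin hu
  have hz₀ : z ∈ E 0 := hz 0 n.zero_le
  obtain ⟨q, hq, rfl⟩ := hP.exists_pow_eq_of_mem hP.invariant_zero L.zero_le hz₀
  have hq₀ : q ≠ 0 := by
    rintro rfl
    have := hP.isStrictTotalOrder 0
    exact irrefl _ (hP.isReversed_of_mem hz₀).2.2.1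
  by_contra! hLn
  refine hw (L - q) (by omega) ?_
  have := hz (L - q) (by omega)
  rwa [← Equiv.Perm.mul_apply, ← pow_add, Nat.sub_add_cancel hq] at this

theorem invariant (hP : IsArcProcess δ π c C D F x L r E) (hw : ∀ k < n, (π ^ L) x ∉ E k)
    (hE : ∀ k < n, (E k).Nonempty) : Invariant δ π c D F x r E n := by
  induction n with
  | zero => exact hP.invariant_zero
  | succ n ih =>
    have hI := ih (fun k hk => hw k (by omega)) (fun k hk => hE k (by omega))
    have hnL := hP.lt_of_nonempty hI (fun k hk => hw k (by omega)) (hE n n.lt_succ_self)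
    refine hI.succ hP.toIsMoveProcess hP.subset hP.notMem (hP.bijOn.mapsTo hnL.le)
      (hP.bijOn.mapsTo hnL) (fun u hu => ?_) (hE n n.lt_succ_self)
    obtain ⟨q, hq, rfl⟩ := hP.exists_pow_eq_of_mem hI hnL.le hu
    have hqL : q ≠ L := by rintro rfl; exact hw n n.lt_succ_self hu
    rw [← Equiv.Perm.mul_apply, ← pow_succ']
    exact hP.bijOn.mapsTo (lt_of_le_of_ne hq hqL)

theorem rel_of_rel_zero (hP : IsArcProcess δ π c C D F x L r E) (hw : ∀ k < n, (π ^ L) x ∉ E k)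
    (hE : ∀ k < n, (E k).Nonempty) (hst : ¬ (s ∈ D ∧ t ∈ D) ∨ t = x) (h : r 0 s t) : r n s t := by
  induction n with
  | zero => exact h
  | succ n ih =>
    replace hE k (hk : k ≤ n) := hE k (Nat.lt_succ_iff.2 hk)
    replace hw k (hk : k ≤ n) := hw k (Nat.lt_succ_iff.2 hk)
    have hI := hP.invariant (fun k hk => hw k hk.le) (fun k hk => hE k hk.le)
    have hnL := hP.lt_of_nonempty hI (fun k hk => hw k hk.le) (hE n le_rfl)
    have hα := hP.bijOn.mapsTo hnL.le
    refine (hP.rel_succ_iff hI hP.subset hP.notMem hα (hE n le_rfl) s t).2 (.inl ⟨?_, ?_⟩)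
    · exact ih (fun k hk => hw k hk.le) fun k hk => hE k hk.le
    rintro ⟨rfl, u, hu, rfl⟩
    obtain ⟨q, hq, rfl⟩ := hP.exists_pow_eq_of_mem hI hnL.le hu
    have hqL : q < L := lt_of_le_of_ne hq (by rintro rfl; exact hw n le_rfl hu)
    rw [← Equiv.Perm.mul_apply, ← pow_succ'] at hst
    rcases hst with hst | hst
    · exact hst ⟨hP.bijOn.mapsTo hnL, hP.bijOn.mapsTo hqL⟩
    · exact absurd (hP.bijOn.injOn hqL (Nat.zero_le L) hst) q.succ_ne_zero

theorem exists_eq_empty (hP : IsArcProcess δ π c C D F x L r E) (hw : ∀ k, (π ^ L) x ∉ E k) :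
    ∃ n, E n = ∅ := by
  by_contra! hE
  have hI := hP.invariant (n := L) (fun k _ => hw k) fun k _ => hE k
  exact lt_irrefl L (hP.lt_of_nonempty hI (fun k _ => hw k) (hE L))

theorem of_isReversed_of_eq_empty (hP : IsArcProcess δ π c C D F x L r E)
    (hI : Invariant δ π c D F x r E n) (hE : ∀ k < n, (E k).Nonempty)
    (hn : E n = ∅) (h : IsReversed δ π (r n) s t) : F s t := by
  refine (hI.cases_of_isReversed h).resolve_left fun ⟨ht, hs⟩ => ?_
  have := (hP.mem_iff hE).2 ⟨hP.subset hs, ht ▸ h⟩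
  simp [hn] at this

theorem exists_forall_pow_mem (hP : IsArcProcess δ π c C D F x L r E)
    (h : ∃ n, (π ^ L) x ∈ E n) : ∃ n < L, ∀ k ≤ n, (π ^ (k + (L - n))) x ∈ E k := by
  classical
  have hw := Nat.find_spec h
  have hmin : ∀ k < Nat.find h, (π ^ L) x ∉ E k := fun k => Nat.find_min h
  have hE : ∀ k < Nat.find h, (E k).Nonempty := fun k hk => hP.nonempty_of_le hk.le ⟨_, hw⟩
  have hI := hP.invariant hmin hE
  obtain ⟨z, hzw, hz⟩ := hI.exists_origin hw
  obtain ⟨q, hq, rfl⟩ := hP.exists_pow_eq_of_mem hP.invariant_zero L.zero_le (hz 0 (Nat.zero_le _))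
  simp only [← Equiv.Perm.mul_apply, ← pow_add] at hz hzw
  have hqL : q + Nat.find h = L := by
    rcases lt_trichotomy (q + Nat.find h) L with hlt | heq | hgt
    · exact hP.bijOn.injOn hlt.le (Set.mem_Iic.2 le_rfl) (by rwa [add_comm q])
    · exact heq
    · refine absurd (hz (L - q) (by omega)) ?_
      rw [Nat.sub_add_cancel hq]
      exact hmin _ (by omega)
  refine ⟨_, hP.lt_of_nonempty hI hmin ⟨_, hw⟩, fun k hk => ?_⟩
  have hq : L - Nat.find h = q := by omega
  rw [hq]
  exact hz k hk

end IsArcProcess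

theorem not_rel_pow_of_binExp_eq [Finite T] {r : T → T → Prop} [IsStrictTotalOrder T r]
    (hrev : ∀ s t, ¬ IsReversed δ π r s t) {k : ℕ} (h : binExp δ π ((π ^ k) t) = binExp δ π t) :
    ¬ r ((π ^ k) t) t := by
  intro hr
  have hpow (n : ℕ) : binExp δ π ((π ^ n) ((π ^ k) t)) = binExp δ π ((π ^ n) t) ∧
      r ((π ^ n) ((π ^ k) t)) ((π ^ n) t) := by
    induction n with
    | zero => exact ⟨h, hr⟩
    | succ n ih =>
      rw [pow_succ', Equiv.Perm.mul_apply, Equiv.Perm.mul_apply]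
      exact ⟨binExp_map_eq ih.1, rel_map_of_not_isReversed (δ_eq_of_binExp_eq _ _ _ _ ih.1)
        (hrev _ _) ih.2⟩
  have hiter (q : ℕ) : r (((π ^ k) ^ (q + 1)) t) t := by
    induction q with
    | zero => simpa using hr
    | succ q ih =>
      refine _root_.trans ?_ ih
      simpa [pow_succ, pow_mul] using (hpow (k * (q + 1))).2
  have horder : orderOf (π ^ k) - 1 + 1 = orderOf (π ^ k) :=
    Nat.sub_add_cancel (orderOf_pos _)
  have := hiter (orderOf (π ^ k) - 1)
  rw [horder, pow_orderOf_eq_one] at this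
  exact irrefl _ this

end MoveProcess

section Stage

variable {T : Type}

theorem mem_setA_iff [Fintype T] (R : ABS T) (A : Set T) (α t : T) :
    t ∈ R.setA A α ↔ t ∈ A ∧ IsReversed R.δ R.π R.ord.lt t α := by
  simp only [setA, IsReversed, mem_filter_univ]
  tauto

theorem mem_setB_iff [Fintype T] (R : ABS T) (β t : T) :
    t ∈ R.setB β ↔ IsReversed R.δ R.π (fun s t => R.ord.lt t s) t β := by
  simp only [setB, IsReversed, mem_filter_univ]
  tauto

variable [DecidableEq T]

theorem moveRight_lt_iff_of_ne (S : ABS T) {u v s t : T} (hs : s ≠ u) (ht : t ≠ u) :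
    (S.moveRight u v).ord.lt s t ↔ S.ord.lt s t := by
  let := S.ord
  refine (Prod.Lex.lt_iff
    (x := (toLex (if s = u then (v, 1) else (s, 0)) : T ×ₗ Fin 2))
    (y := (toLex (if t = u then (v, 1) else (t, 0)) : T ×ₗ Fin 2))).trans ?_
  simp [hs, ht]

theorem moveRight_lt_self_iff (S : ABS T) {u v t : T} (ht : t ≠ u) :
    (S.moveRight u v).ord.lt t u ↔ t = v ∨ S.ord.lt t v := by
  let := S.ord
  refine (Prod.Lex.lt_iff
    (x := (toLex (if t = u then (v, 1) else (t, 0)) : T ×ₗ Fin 2))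
    (y := (toLex (if u = u then (v, 1) else (u, 0)) : T ×ₗ Fin 2))).trans ?_
  simp [ht, or_comm]

theorem moveLeft_lt_iff_of_ne (S : ABS T) {u v s t : T} (hs : s ≠ u) (ht : t ≠ u) :
    (S.moveLeft u v).ord.lt s t ↔ S.ord.lt s t := by
  let := S.ord
  refine (Prod.Lex.lt_iff
    (x := (toLex (if s = u then (v, 0) else (s, 1)) : T ×ₗ Fin 2))
    (y := (toLex (if t = u then (v, 0) else (t, 1)) : T ×ₗ Fin 2))).trans ?_
  simp [hs, ht]

theorem moveLeft_self_lt_iff (S : ABS T) {u v t : T} (ht : t ≠ u) :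
    (S.moveLeft u v).ord.lt u t ↔ t = v ∨ S.ord.lt v t := by
  let := S.ord
  refine (Prod.Lex.lt_iff
    (x := (toLex (if u = u then (v, 0) else (u, 1)) : T ×ₗ Fin 2))
    (y := (toLex (if t = u then (v, 0) else (t, 1)) : T ×ₗ Fin 2))).trans ?_
  simp [ht, or_comm, eq_comm]

variable [Fintype T] (S : ABS T) (A : Set T) (x y : T)

theorem stageA_π_δ (n : ℕ) : (stageA S A x y n).1.π = smallMod S.π x y ∧
    (stageA S A x y n).1.δ = S.δ := by
  induction n with
  | zero => exact ⟨rfl, rfl⟩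
  | succ n ih =>
    rw [stageA]
    dsimp only
    split_ifs <;> exact ih

theorem stageB_π_δ (n : ℕ) : (stageB S A x y n).1.π = smallMod S.π x y ∧
    (stageB S A x y n).1.δ = S.δ := by
  induction n with
  | zero => exact stageA_π_δ S A x y _
  | succ n ih =>
    rw [stageB]
    dsimp only
    split_ifs <;> exact ih

theorem isMoveProcess_stageA : IsMoveProcess S.δ (smallMod S.π x y) A x
    (fun n => (stageA S A x y n).1.ord.lt) (fun n => (stageA S A x y n).2) where
  isStrictTotalOrder n := @instIsStrictTotalOrderLt T (stageA S A x y n).1.ord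
  mem_iff {n t} hE := by
    rw [← (stageA_π_δ S A x y n).1, ← (stageA_π_δ S A x y n).2]
    cases n with
    | zero => exact mem_setA_iff _ A x t
    | succ n =>
      rw [stageA]
      dsimp only
      rw [dif_pos (hE n n.lt_succ_self)]
      exact mem_setA_iff _ A _ t
  eq_empty_succ hE := by simp [stageA, hE]
  exists_max {n} hE := by
    rw [← (stageA_π_δ S A x y n).1, stageA, dif_pos hE]
    let := (stageA S A x y n).1.ord
    exact ⟨_, max'_mem _ hE, fun t ht => (le_max' _ t ht).eq_or_lt,
      moveRight_lt_iff_of_ne _, moveRight_lt_self_iff _⟩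

theorem isMoveProcess_stageB : IsMoveProcess S.δ (smallMod S.π x y) Set.univ y
    (fun n s t => (stageB S A x y n).1.ord.lt t s) (fun n => (stageB S A x y n).2) where
  isStrictTotalOrder n := by
    let := (stageB S A x y n).1.ord
    exact inferInstanceAs (IsStrictTotalOrder T (· > ·))
  mem_iff {n t} hE := by
    rw [← (stageB_π_δ S A x y n).1, ← (stageB_π_δ S A x y n).2]
    simp only [Set.mem_univ, true_and]
    cases n with
    | zero => exact mem_setB_iff _ y t
    | succ n =>
      rw [stageB]
      dsimp only
      rw [dif_pos (hE n n.lt_succ_self)]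
      exact mem_setB_iff _ _ t
  eq_empty_succ hE := by simp [stageB, hE]
  exists_max {n} hE := by
    rw [← (stageB_π_δ S A x y n).1, stageB, dif_pos hE]
    let := (stageB S A x y n).1.ord
    exact ⟨_, min'_mem _ hE, fun t ht => (min'_le _ t ht).eq_or_lt.imp_left Eq.symm,
      fun hs ht => moveLeft_lt_iff_of_ne _ ht hs, moveLeft_self_lt_iff _⟩

end Stage

section Arc

variable {T : Type} [DecidableEq T] {m n : ℕ} {π : Equiv.Perm T} {f : Fin (m + n) → T}
  {k w : Fin (m + n)} {y : T} {q : ℕ}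

theorem simple_π_pow_val (q : ℕ) (k : Fin (m + n)) :
    (((simple m n).π ^ q) k : ℕ) = (k + q * n) % (m + n) := by
  induction q with
  | zero => simp [Nat.mod_eq_of_lt k.2]
  | succ q ih =>
    have hval (l : Fin (m + n)) : ((simple m n).π l : ℕ) = (l + n) % (m + n) := by
      rw [simple_π_val]
      split_ifs with hl
      · rw [Nat.mod_eq_of_lt (by omega)]
      · rw [Nat.mod_eq_sub_mod (by omega), Nat.mod_eq_of_lt (by omega)]
        omega
    rw [pow_succ', Equiv.Perm.mul_apply, hval, ih, Nat.mod_add_mod, add_assoc, ← Nat.succ_mul]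

theorem simple_π_pow_card (k : Fin (m + n)) : ((simple m n).π ^ (m + n)) k = k :=
  Fin.ext (by rw [simple_π_pow_val, Nat.add_mul_mod_self_left, Nat.mod_eq_of_lt k.2])

theorem simple_π_pow_injOn (hc : m.Coprime n) (k : Fin (m + n)) :
    Set.InjOn (fun q => ((simple m n).π ^ q) k) (Set.Iio (m + n)) := by
  intro p hp q hq hpq
  have hmod : k + p * n ≡ k + q * n [MOD m + n] := by
    simpa only [simple_π_pow_val, Nat.ModEq] using congrArg Fin.val hpq
  have hcop : (m + n).gcd n = 1 := by simpa using hc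
  exact ((Nat.ModEq.add_left_cancel' _ hmod).cancel_right_of_coprime hcop).eq_of_lt_of_lt hp hq

theorem simple_π_pow_ne (hc : m.Coprime n) (hq₀ : 0 < q) (hq : q < m + n) :
    ((simple m n).π ^ q) k ≠ k := fun h =>
  hq₀.ne' (simple_π_pow_injOn hc k hq (hq₀.trans hq) h)

theorem bijOn_simple_π_pow (hc : m.Coprime n) (k : Fin (m + n)) :
    Set.BijOn (fun q => ((simple m n).π ^ q) k) (Set.Iio (m + n)) Set.univ := by
  refine ⟨Set.mapsTo_univ _ _, simple_π_pow_injOn hc k, fun l _ => ?_⟩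
  have hbij : Function.Bijective fun q : Fin (m + n) => ((simple m n).π ^ (q : ℕ)) k :=
    Finite.injective_iff_bijective.1 fun p q h =>
      Fin.ext (simple_π_pow_injOn hc k p.2 q.2 h)
  obtain ⟨q, hq⟩ := hbij.surjective l
  exact ⟨q, q.2, hq⟩

theorem smallMod_pow_apply (hc : m.Coprime n) (hf : f.Injective)
    (hπ : Function.Semiconj f (simple m n).π π) (hy : y ∉ Set.range f) (hq : q < m + n) :
    (smallMod π (f k) y ^ q) (f k) = f (((simple m n).π ^ q) k) := by
  induction q with
  | zero => rfl
  | succ q ih =>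
    rw [pow_succ', Equiv.Perm.mul_apply, ih (by omega), smallMod, Equiv.trans_apply, ← hπ,
      ← Equiv.Perm.mul_apply, ← pow_succ']
    refine Equiv.swap_apply_of_ne_of_ne ?_ fun h => hy ⟨_, h⟩
    exact hf.ne (simple_π_pow_ne hc q.succ_pos hq)

theorem bijOn_smallMod_pow (hc : m.Coprime n) (hf : f.Injective)
    (hπ : Function.Semiconj f (simple m n).π π) (hy : y ∉ Set.range f) :
    Set.BijOn (fun q => (smallMod π (f k) y ^ q) (f k)) (Set.Iic (m + n - 1)) (Set.range f) := by
  have hIic : Set.Iic (m + n - 1) = Set.Iio (m + n) := Set.ext fun q => Nat.le_sub_one_iff_lt k.pos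
  rw [hIic]
  have hbij : Set.BijOn f Set.univ (Set.range f) := Set.image_univ ▸ hf.injOn.bijOn_image
  exact (hbij.comp (bijOn_simple_π_pow hc k)).congr fun q hq =>
    (smallMod_pow_apply hc hf hπ hy hq).symm

theorem smallMod_pow_apply_eq (hc : m.Coprime n) (hf : f.Injective)
    (hπ : Function.Semiconj f (simple m n).π π) (hy : y ∉ Set.range f)
    (hw : (simple m n).π w = k) : (smallMod π (f k) y ^ (m + n - 1)) (f k) = f w := by
  have hpos : 0 < m + n := k.pos
  rw [smallMod_pow_apply hc hf hπ hy (by omega)]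
  refine congrArg f ((simple m n).π.injective ?_)
  rw [← Equiv.Perm.mul_apply, ← pow_succ', Nat.sub_add_cancel hpos, simple_π_pow_card, hw]

theorem smallMod_pow_card (hc : m.Coprime n) (hf : f.Injective)
    (hπ : Function.Semiconj f (simple m n).π π) (hy : y ∉ Set.range f) :
    (smallMod π (f k) y ^ (m + n)) (f k) = y := by
  obtain ⟨w, hw⟩ := (simple m n).π.surjective k
  rw [← Nat.sub_add_cancel (show 1 ≤ m + n from k.pos), pow_succ', Equiv.Perm.mul_apply,
    smallMod_pow_apply_eq hc hf hπ hy hw, smallMod, Equiv.trans_apply, ← hπ, hw,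
    Equiv.swap_apply_left]

theorem simple_δ (k : Fin (m + n)) : (simple m n).δ k = if (k : ℕ) < m then 1 else 0 := rfl

theorem simple_π_lt_iff (k : Fin (m + n)) :
    ((simple m n).π k : ℕ) < n ↔ (simple m n).δ k = 0 := by
  rw [simple_π_val, simple_δ]
  grind

theorem simple_π_pow_add_eq {k l : Fin (m + n)} (h : ∀ r < q,
      (simple m n).δ (((simple m n).π ^ r) k) = (simple m n).δ (((simple m n).π ^ r) l)) :
    (((simple m n).π ^ q) k : ℕ) + l = ((simple m n).π ^ q) l + k := by
  induction q with
  | zero => exact add_comm _ _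
  | succ q ih =>
    have hq := h q q.lt_succ_self
    have ih := ih fun r hr => h r (hr.trans q.lt_succ_self)
    rw [simple_δ, simple_δ] at hq
    rw [pow_succ', Equiv.Perm.mul_apply, Equiv.Perm.mul_apply, simple_π_val, simple_π_val]
    grind

/-- The element `f w` with `ψ (f w) = y` is reached from some `f b ∈ E 0`; the power of `ψ` taking
`f b` to `y` takes `f k` to `f a`. The corresponding power of `N_{m,n}` takes `b` to `k` and `k` to
`a`, and it shifts both by the same amount since all the symbols on the way agree. -/
theorem exists_add_eq_two_mul {δ : T → Fin 2} {c : Fin 2} {C D : Set T} {F : T → T → Prop}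
    {r : ℕ → T → T → Prop} {E : ℕ → Finset T} (hc : m.Coprime n) (hf : f.Injective)
    (hπ : Function.Semiconj f (simple m n).π π) (hy : y ∉ Set.range f)
    (hδ : ∀ l, δ (f l) = (simple m n).δ l)
    (hP : IsArcProcess δ (smallMod π (f k) y) c C D F (f k) (m + n - 1) r E)
    (h : ∃ l, (smallMod π (f k) y ^ (m + n - 1)) (f k) ∈ E l) :
    ∃ a b : Fin (m + n), (a : ℕ) + b = 2 * k ∧ ((a : ℕ) < n ↔ (k : ℕ) < n) ∧ f b ∈ E 0 ∧
      let 𝔟 := binExp δ (smallMod π (f k) y)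
      (𝔟 y < 𝔟 (f a) ↔ 𝔟 (f b) < 𝔟 (f k)) ∧ (𝔟 (f a) < 𝔟 y ↔ 𝔟 (f k) < 𝔟 (f b)) := by
  set ρ := (simple m n).π
  set ψ := smallMod π (f k) y
  have hpos : 0 < m + n := k.pos
  obtain ⟨p, hp, hmem⟩ := hP.exists_forall_pow_mem h
  have hpow {q} (hq : q < m + n) : (ψ ^ q) (f k) = f ((ρ ^ q) k) :=
    smallMod_pow_apply hc hf hπ hy hq
  set b := (ρ ^ (m + n - 1 - p)) k
  have hfb (q) : (ψ ^ q) (f b) = (ψ ^ (q + (m + n - 1 - p))) (f k) := by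
    rw [pow_add, Equiv.Perm.mul_apply, hpow (q := m + n - 1 - p) (by omega)]
  have hδψ (q) (hq : q < p + 1) : δ ((ψ ^ q) (f b)) = δ ((ψ ^ q) (f k)) := by
    rw [hfb]
    exact (hP.isReversed_of_mem (hmem q (by omega))).2.1
  have hδρ (q) (hq : q < p + 1) : (simple m n).δ ((ρ ^ q) b) = (simple m n).δ ((ρ ^ q) k) := by
    have := hδψ q hq
    rwa [hfb, hpow (by omega), hpow (by omega), hδ, hδ, pow_add, Equiv.Perm.mul_apply] at this
  have hshift : ((ρ ^ (p + 1)) b : ℕ) + k = (ρ ^ (p + 1)) k + b := simple_π_pow_add_eq hδρ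
  have hzone : ((ρ ^ (p + 1)) k : ℕ) < n ↔ ((ρ ^ (p + 1)) b : ℕ) < n := by
    rw [pow_succ', Equiv.Perm.mul_apply, Equiv.Perm.mul_apply, simple_π_lt_iff, simple_π_lt_iff,
      hδρ p p.lt_succ_self]
  have hcard : p + 1 + (m + n - 1 - p) = m + n := by omega
  have hρb : (ρ ^ (p + 1)) b = k := by
    rw [← Equiv.Perm.mul_apply, ← pow_add, hcard, simple_π_pow_card]
  have hend : (ψ ^ (p + 1)) (f b) = y := by
    rw [hfb, hcard, smallMod_pow_card hc hf hπ hy]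
  rw [hρb] at hshift hzone
  refine ⟨(ρ ^ (p + 1)) k, b, by omega, hzone, ?_, ?_⟩
  · have := hmem 0 p.zero_le
    rwa [zero_add, hpow (by omega)] at this
  · dsimp only
    rw [← hend, ← hpow (q := p + 1) (by omega)]
    exact ⟨binExp_pow_lt hδψ, binExp_pow_lt fun q hq => (hδψ q hq).symm⟩

end Arc

section Moves

variable {m₁ n₁ m₂ n₂ : ℕ} {i w c : Fin (m₁ + n₁)} {j v d : Fin (m₂ + n₂)}
  {s t : Fin (m₁ + n₁) ⊕ Fin (m₂ + n₂)}

local notation "S" => twoSegment m₁ n₁ m₂ n₂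
local notation "κ" => pos m₁ n₁ m₂ n₂
local notation "σ" => ABS.π (simple m₁ n₁)
local notation "τ" => ABS.π (simple m₂ n₂)
local notation "φ" => Equiv.swap (Sum.inl i) (Sum.inr j)
local notation "ψ" => smallMod (ABS.π (twoSegment m₁ n₁ m₂ n₂)) (Sum.inl i) (Sum.inr j)
local notation "𝔟" => binExp (ABS.δ (twoSegment m₁ n₁ m₂ n₂)) ψ
local notation "𝔸" => stageA (twoSegment m₁ n₁ m₂ n₂) (Set.range Sum.inl) (Sum.inl i) (Sum.inr j)
local notation "𝔹" => stageB (twoSegment m₁ n₁ m₂ n₂) (Set.range Sum.inl) (Sum.inl i) (Sum.inr j)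
local notation "𝔞" => stopA (twoSegment m₁ n₁ m₂ n₂) (Set.range Sum.inl) (Sum.inl i) (Sum.inr j)

theorem bijOn_smallMod_pow_inl (hc : m₁.Coprime n₁) :
    Set.BijOn (fun q => (ψ ^ q) (.inl i)) (Set.Iic (m₁ + n₁ - 1)) (Set.range Sum.inl) :=
  bijOn_smallMod_pow hc Sum.inl_injective (fun _ => rfl) (by simp)

theorem bijOn_smallMod_pow_inr (hc : m₂.Coprime n₂) :
    Set.BijOn (fun q => (ψ ^ q) (.inr j)) (Set.Iic (m₂ + n₂ - 1)) (Set.range Sum.inr) := by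
  rw [smallMod, Equiv.swap_comm]
  exact bijOn_smallMod_pow hc Sum.inr_injective (fun _ => rfl) (by simp)

theorem smallMod_pow_inl_eq (hc : m₁.Coprime n₁) (hw : σ w = i) :
    (ψ ^ (m₁ + n₁ - 1)) (.inl i) = .inl w :=
  smallMod_pow_apply_eq hc Sum.inl_injective (fun _ => rfl) (by simp) hw

theorem smallMod_pow_inr_eq (hc : m₂.Coprime n₂) (hv : τ v = j) :
    (ψ ^ (m₂ + n₂ - 1)) (.inr j) = .inr v := by
  rw [smallMod, Equiv.swap_comm]
  exact smallMod_pow_apply_eq hc Sum.inr_injective (fun _ => rfl) (by simp) hv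

theorem stageA_zero_lt_iff (h₁ : m₁ < n₁) (h₂ : n₂ < m₂) :
    (𝔸 0).1.ord.lt s t ↔ κ (φ s) < κ (φ t) :=
  twoSegment_lt_iff h₁ h₂ (φ s) (φ t)

theorem cases_of_isReversed_stageA_zero (h₁ : m₁ < n₁) (h₂ : n₂ < m₂)
    (hi : m₁ ≤ (i : ℕ) ∧ (i : ℕ) < n₁) (hj : (j : ℕ) < n₂)
    (h : IsReversed (S).δ ψ (𝔸 0).1.ord.lt s t) :
    (t = .inl i ∧ (∃ c, s = .inl c) ∧ κ s ∈ Set.Ioo (κ (.inl i)) (κ (.inr j))) ∨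
      (s = .inr j ∧ (∃ d, t = .inr d) ∧ κ t ∈ Set.Ioo (κ (.inl i)) (κ (.inr j))) := by
  have hκ := isStable_pos h₁ h₂
  obtain ⟨hδ, hst, hts⟩ := h
  rw [stageA_zero_lt_iff h₁ h₂] at hst hts
  rw [swap_smallMod, swap_smallMod, hκ.map_lt_map_iff hδ.symm] at hts
  have hxy : κ (.inl i) < κ (.inr j) := by rw [pos_inl, pos_inr]; grind
  rcases lt_or_of_swap_lt hκ.injective hxy hst with h | ⟨rfl, rfl⟩ | ⟨rfl, ht⟩ | ⟨rfl, hs⟩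
  · exact absurd h hts.not_gt
  · simp only [twoSegment_δ_inl, twoSegment_δ_inr] at hδ
    grind
  · rcases t with c | d
    · simp only [twoSegment_δ_inl, twoSegment_δ_inr, pos_inl, pos_inr, Set.mem_Ioo] at hδ ht
      grind
    · exact .inr ⟨rfl, ⟨d, rfl⟩, ht⟩
  · rcases s with c | d
    · exact .inl ⟨rfl, ⟨c, rfl⟩, hs⟩
    · simp only [twoSegment_δ_inl, twoSegment_δ_inr, pos_inl, pos_inr, Set.mem_Ioo] at hδ hs
      grind

theorem isArcProcess_stageA (hc : m₁.Coprime n₁) (h₁ : m₁ < n₁) (h₂ : n₂ < m₂)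
    (hi : m₁ ≤ (i : ℕ) ∧ (i : ℕ) < n₁) (hj : (j : ℕ) < n₂) :
    IsArcProcess (S).δ ψ 0 (Set.range Sum.inl) (Set.range Sum.inl)
      (fun s t => s = .inr j ∧ (∃ d, t = .inr d) ∧ κ t ∈ Set.Ioo (κ (.inl i)) (κ (.inr j)))
      (.inl i) (m₁ + n₁ - 1) (fun n => (𝔸 n).1.ord.lt) (fun n => (𝔸 n).2) where
  toIsMoveProcess := isMoveProcess_stageA _ _ _ _
  invariant_zero :=
    { map_rel_map := fun {s t} hs ht => by
        rw [stageA_zero_lt_iff h₁ h₂, swap_smallMod, swap_smallMod]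
        exact (isStable_pos h₁ h₂).map_lt_map (by omega)
      cases_of_isReversed := fun {s t} h => by
        refine (cases_of_isReversed_stageA_zero h₁ h₂ hi hj h).imp_left ?_
        rintro ⟨rfl, ⟨c, rfl⟩, -⟩
        exact ⟨rfl, c, rfl⟩
      exists_origin := fun {u} hu => ⟨u, rfl, fun k hk => by rwa [Nat.le_zero.1 hk]⟩ }
  subset := subset_rfl
  notMem := by rintro _ _ ⟨rfl, ⟨d, rfl⟩, -⟩; simp
  bijOn := bijOn_smallMod_pow_inl hc

variable (hc₁ : m₁.Coprime n₁) (hc₂ : m₂.Coprime n₂) (h₁ : m₁ < n₁) (h₂ : n₂ < m₂)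
  (hi : m₁ ≤ (i : ℕ) ∧ (i : ℕ) < n₁) (hj : (j : ℕ) < n₂)
include hc₁ h₁ h₂ hi hj

theorem stageA_stopA (hw : σ w = i) (hA : ∀ n, .inl w ∉ (𝔸 n).2) :
    (𝔸 𝔞).2 = ∅ ∧ ∀ k < 𝔞, (𝔸 k).2.Nonempty := by
  have hne : {n | (𝔸 n).2 = ∅}.Nonempty :=
    (isArcProcess_stageA hc₁ h₁ h₂ hi hj).exists_eq_empty fun k =>
      (smallMod_pow_inl_eq hc₁ hw).symm ▸ hA k
  exact ⟨Nat.sInf_mem hne, fun k hk => nonempty_iff_ne_empty.2 (Nat.notMem_of_lt_sInf hk)⟩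

theorem eq_inr_of_isReversed_stageB_zero (hw : σ w = i) (hA : ∀ n, .inl w ∉ (𝔸 n).2)
    (h : IsReversed (S).δ ψ (𝔹 0).1.ord.lt s t) :
    s = .inr j ∧ (∃ d, t = .inr d) ∧ κ t ∈ Set.Ioo (κ (.inl i)) (κ (.inr j)) := by
  have hP := isArcProcess_stageA hc₁ h₁ h₂ hi hj
  obtain ⟨hempty, hne⟩ := stageA_stopA hc₁ h₁ h₂ hi hj hw hA
  exact hP.of_isReversed_of_eq_empty
    (hP.invariant (fun k _ => (smallMod_pow_inl_eq hc₁ hw).symm ▸ hA k) hne) hne hempty h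

include hc₂ in
theorem isArcProcess_stageB (hw : σ w = i) (hA : ∀ n, .inl w ∉ (𝔸 n).2) :
    IsArcProcess (S).δ ψ 1 Set.univ (Set.range Sum.inr) (fun _ _ => False) (.inr j)
      (m₂ + n₂ - 1) (fun n s t => (𝔹 n).1.ord.lt t s) (fun n => (𝔹 n).2) where
  toIsMoveProcess := isMoveProcess_stageB _ _ _ _
  invariant_zero :=
    { map_rel_map := fun {s t} hs ht => by
        have hP := isArcProcess_stageA hc₁ h₁ h₂ hi hj
        refine (hP.invariant (fun k _ => ?_) (stageA_stopA hc₁ h₁ h₂ hi hj hw hA).2).map_rel_map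
          (by omega) (by omega)
        exact (smallMod_pow_inl_eq hc₁ hw).symm ▸ hA k
      cases_of_isReversed := fun {s t} h => by
        obtain ⟨rfl, ⟨d, rfl⟩, -⟩ :=
          eq_inr_of_isReversed_stageB_zero hc₁ h₁ h₂ hi hj hw hA ⟨h.1.symm, h.2⟩
        exact .inl ⟨rfl, d, rfl⟩
      exists_origin := fun {u} hu => ⟨u, rfl, fun k hk => by rwa [Nat.le_zero.1 hk]⟩ }
  subset := Set.subset_univ _
  notMem := fun _ _ => False.elim
  bijOn := bijOn_smallMod_pow_inr hc₂

include hc₂ in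
theorem exists_isStrictTotalOrder_not_isReversed (hw : σ w = i) (hA : ∀ n, .inl w ∉ (𝔸 n).2)
    (hv : τ v = j) (hB : ∀ n, .inr v ∉ (𝔹 n).2) :
    ∃ r : Fin (m₁ + n₁) ⊕ Fin (m₂ + n₂) → Fin (m₁ + n₁) ⊕ Fin (m₂ + n₂) → Prop,
      IsStrictTotalOrder _ r ∧ (∀ {s t}, (S).δ s < (S).δ t → r (ψ s) (ψ t)) ∧
      (∀ s t, ¬ IsReversed (S).δ ψ r s t) ∧
      ∀ {s t}, (s.isLeft ≠ t.isLeft ∨ s = .inr j ∨ t = .inl i) → κ (φ s) < κ (φ t) → r s t := by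
  have hPA := isArcProcess_stageA hc₁ h₁ h₂ hi hj
  have hPB := isArcProcess_stageB hc₁ hc₂ h₁ h₂ hi hj hw hA
  obtain ⟨-, hneA⟩ := stageA_stopA hc₁ h₁ h₂ hi hj hw hA
  have hwA k : (ψ ^ (m₁ + n₁ - 1)) (.inl i) ∉ (𝔸 k).2 := (smallMod_pow_inl_eq hc₁ hw).symm ▸ hA k
  have hvB k : (ψ ^ (m₂ + n₂ - 1)) (.inr j) ∉ (𝔹 k).2 := (smallMod_pow_inr_eq hc₂ hv).symm ▸ hB k
  have hex := hPB.exists_eq_empty hvB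
  classical
  have hneB k (hk : k < Nat.find hex) := nonempty_iff_ne_empty.2 (Nat.find_min hex hk)
  have hI := hPB.invariant (fun k _ => hvB k) hneB
  refine ⟨(𝔹 (Nat.find hex)).1.ord.lt, @instIsStrictTotalOrderLt _ (𝔹 (Nat.find hex)).1.ord,
    fun h => hI.map_rel_map (by omega) (by omega), fun s t h =>
      hPB.of_isReversed_of_eq_empty hI hneB (Nat.find_spec hex) ⟨h.1.symm, h.2⟩,
    fun {s t} hst h => ?_⟩
  refine hPB.rel_of_rel_zero (fun k _ => hvB k) hneB ?_ <|
    hPA.rel_of_rel_zero (fun k _ => hwA k) hneA ?_ ((stageA_zero_lt_iff h₁ h₂).2 h)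
  · rcases s with c | d <;> rcases t with e | f <;> simp_all
  · rcases s with c | d <;> rcases t with e | f <;> simp_all

omit hc₁ h₁ in
theorem isLeft_ne_of_zero_lt_one (hs : (S).δ s = 0) (ht : (S).δ t = 1) (h : κ (φ s) < κ (φ t)) :
    s.isLeft ≠ t.isLeft := by
  rcases s with a | a <;> rcases t with b | b <;>
    simp only [twoSegment_δ_inl, twoSegment_δ_inr, Equiv.swap_apply_def] at hs ht h <;>
    split_ifs at h <;> simp only [pos_inl, pos_inr] at h <;> grind

include hc₂ in
theorem isGood_of_notMem (hw : σ w = i) (hA : ∀ n, .inl w ∉ (𝔸 n).2) (hv : τ v = j)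
    (hB : ∀ n, .inr v ∉ (𝔹 n).2) :
    IsGood κ (S).δ (S).π (.inl i) (.inr j) := by
  obtain ⟨r, hr, hlt, hrev, hrel⟩ :=
    exists_isStrictTotalOrder_not_isReversed hc₁ hc₂ h₁ h₂ hi hj hw hA hv hB
  have binExp_lt {s t} (h : r s t) (hne : 𝔟 s ≠ 𝔟 t) : 𝔟 s < 𝔟 t :=
    hne.lt_or_gt.resolve_right fun h' => asymm h <| rel_of_binExp_lt (fun _ _ => hlt)
      (fun s t hδ => rel_map_of_not_isReversed hδ (hrev s t)) h'
  refine ⟨fun {s t} hs ht h => ?_, fun {z} hz hδ => ?_, fun {z} hz hδ => ?_⟩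
  · refine binExp_lt (hrel (.inl (isLeft_ne_of_zero_lt_one h₂ hi hj hs ht h)) h) fun h' => ?_
    have := δ_eq_of_binExp_eq _ _ _ _ h'
    omega
  · have h : r z (.inl i) := hrel (by simp) (by
      rw [swap_apply_of_mem_Ioo hz, Equiv.swap_apply_left]; exact hz.2)
    obtain ⟨k, -, rfl⟩ : z ∈ (fun q => (ψ ^ q) (.inl i)) '' Set.Iic (m₁ + n₁ - 1) := by
      rw [(bijOn_smallMod_pow_inl hc₁).image_eq]
      rcases z with c | d
      · exact ⟨c, rfl⟩
      · simp only [twoSegment_δ_inr, pos_inl, pos_inr, Set.mem_Ioo] at hδ hz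
        grind
    exact binExp_lt h fun h' => not_rel_pow_of_binExp_eq hrev h' h
  · have h : r (.inr j) z := hrel (by simp) (by
      rw [swap_apply_of_mem_Ioo hz, Equiv.swap_apply_right]; exact hz.1)
    obtain ⟨k, -, rfl⟩ : z ∈ (fun q => (ψ ^ q) (.inr j)) '' Set.Iic (m₂ + n₂ - 1) := by
      rw [(bijOn_smallMod_pow_inr hc₂).image_eq]
      rcases z with c | d
      · simp only [twoSegment_δ_inl, pos_inl, pos_inr, Set.mem_Ioo] at hδ hz
        grind
      · exact ⟨d, rfl⟩
    have : IsStrictTotalOrder _ (Function.swap r) := {}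
    exact binExp_lt h fun h' => not_rel_pow_of_binExp_eq (r := Function.swap r)
      (fun s t h => hrev t s ⟨h.1.symm, h.2⟩) h'.symm h

omit hc₁ in
theorem IsGood.binExp_inl_le_inr_self (hG : IsGood κ (S).δ (S).π (.inl i) (.inr j))
    (ha : c < i) (han : i + m₁ < c + n₁) : 𝔟 (.inl c) ≤ 𝔟 (.inr j) := by
  refine hG.binExp_inl_le_inr (isStable_pos h₁ h₂) (fun a b : Fin _ =>
    (a : ℕ) < n₁ ∧ (b : ℕ) < n₂ ∧ i + m₁ < a + n₁ ∨ n₁ ≤ (a : ℕ) ∧ n₂ ≤ (b : ℕ) ∧ i + m₁ < a)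
    (fun a b hQ => ?_) (fun a b _ hQ hδ => ?_) ?_ ?_ (.inl (by grind))
  · rw [twoSegment_δ_inl, twoSegment_δ_inr]; grind
  · have hσ := simple_π_val a
    have hτ := simple_π_val b
    simp only [twoSegment_δ_inl, twoSegment_δ_inr] at hδ
    rcases hQ with hQ | hQ
    · exact .inr ⟨by grind, by grind, by grind⟩
    · by_cases hb : τ b = j
      · left
        rw [smallMod_inl_of_ne (by grind), smallMod_inr_of_eq hb]
        exact (hG.binExp_inl_lt hi.1 (by grind) (by rw [pos_inl, pos_inr]; grind)).le
      · exact .inr ⟨by grind, hb, by grind⟩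
  · rw [pos_inl, pos_inr]; grind
  · rw [Equiv.swap_apply_of_ne_of_ne (by grind) (by grind), Equiv.swap_apply_right, pos_inl,
      pos_inl]
    grind

theorem IsGood.inl_notMem (hG : IsGood κ (S).δ (S).π (.inl i) (.inr j)) (hw : σ w = i) (n : ℕ) :
    .inl w ∉ (𝔸 n).2 := by
  intro hmem
  have hP := isArcProcess_stageA hc₁ h₁ h₂ hi hj
  obtain ⟨a, c, hac, -, hc, hlt, -⟩ := exists_add_eq_two_mul hc₁ Sum.inl_injective (fun _ => rfl)
    (by simp) (fun _ => rfl) hP ⟨n, (smallMod_pow_inl_eq hc₁ hw).symm ▸ hmem⟩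
  have hrev := (hP.isReversed_of_mem hc).2
  obtain ⟨-, -, hIoo⟩ := (cases_of_isReversed_stageA_zero h₁ h₂ hi hj hrev).resolve_right (by simp)
  have hδ : (S).δ (.inl c) = 0 :=
    hrev.1.trans (by rw [pow_zero, Equiv.Perm.one_apply, twoSegment_δ_inl]; grind)
  have hia : i < c ∧ (c : ℕ) < n₁ := by
    rw [pos_inl, pos_inl, pos_inr] at hIoo
    grind
  refine (hG.binExp_inl_le_inr_self (c := a) h₁ h₂ hi hj ?_ ?_).not_gt
    (hlt.2 (hG.lt_left hIoo hδ)) <;> grind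

include hc₂ in
theorem IsGood.inr_notMem (hG : IsGood κ (S).δ (S).π (.inl i) (.inr j)) (hw : σ w = i)
    (hv : τ v = j) (n : ℕ) : .inr v ∉ (𝔹 n).2 := by
  intro hmem
  have hA := hG.inl_notMem hc₁ h₁ h₂ hi hj hw
  have hP := isArcProcess_stageB hc₁ hc₂ h₁ h₂ hi hj hw hA
  have hcomm : ψ = smallMod (S).π (.inr j) (.inl i) := by rw [smallMod, Equiv.swap_comm]; rfl
  obtain ⟨b, d, hbd, hb, hd, -, hlt⟩ := exists_add_eq_two_mul hc₂ Sum.inr_injective (fun _ => rfl)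
    (by simp) (fun _ => rfl) (hcomm ▸ hP) ⟨n, hcomm ▸ (smallMod_pow_inr_eq hc₂ hv).symm ▸ hmem⟩
  rw [← hcomm] at hlt
  have hrev := (hP.isReversed_of_mem hd).2
  obtain ⟨-, -, hIoo⟩ :=
    eq_inr_of_isReversed_stageB_zero hc₁ h₁ h₂ hi hj hw hA ⟨hrev.1.symm, hrev.2⟩
  have hδ : (S).δ (.inr d) = 1 :=
    hrev.1.trans (by rw [pow_zero, Equiv.Perm.one_apply, twoSegment_δ_inr]; grind)
  have hdj : d < j := by
    rw [pos_inl, pos_inr, pos_inr] at hIoo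
    grind
  refine (hlt.2 (hG.right_lt hIoo hδ)).not_gt (hG.zero_lt_one ?_ ?_ ?_)
  · rw [twoSegment_δ_inl]; grind
  · rw [twoSegment_δ_inr]; grind
  · rw [Equiv.swap_apply_left, Equiv.swap_apply_of_ne_of_ne (by grind) (by grind), pos_inr,
      pos_inr]
    grind

include hc₂ in
theorem isGood_iff_notMem (hw : σ w = i) (hv : τ v = j) :
    IsGood κ (S).δ (S).π (.inl i) (.inr j) ↔
      ¬ ∃ n, .inl w ∈ (𝔸 n).2 ∨ .inr v ∈ (𝔹 n).2 := by
  simp only [not_exists, not_or, forall_and]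
  exact ⟨fun hG => ⟨hG.inl_notMem hc₁ h₁ h₂ hi hj hw, hG.inr_notMem hc₁ hc₂ h₁ h₂ hi hj hw hv⟩,
    fun h => isGood_of_notMem hc₁ hc₂ h₁ h₂ hi hj hw h.1 hv h.2⟩

end Moves

section Dual

variable {T U L L' : Type} [Fintype T] [Fintype U] [LinearOrder L] [LinearOrder L']
  {δ : T → Fin 2} {δ' : U → Fin 2} {π : Equiv.Perm T} {π' : Equiv.Perm U} {f : T → L} {f' : U → L'}

theorem zeroOneCount_of_antitone (e : T ≃ U) (hδ : ∀ t, δ' (e t) = 1 - δ t)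
    (hf : ∀ s t, f' (e s) < f' (e t) ↔ f t < f s) : zeroOneCount δ' f' = zeroOneCount δ f := by
  refine (card_equiv ((Equiv.prodComm T T).trans (e.prodCongr e)) ?_).symm
  rintro ⟨s, t⟩
  simp only [mem_filter_univ, Equiv.trans_apply, Equiv.prodComm_apply, Prod.swap_prod_mk,
    Equiv.prodCongr_apply, Prod.map_apply, hδ, hf]
  have hone_sub (a : Fin 2) : (1 - a = 0 ↔ a = 1) ∧ (1 - a = 1 ↔ a = 0) := by omega
  rw [(hone_sub _).1, (hone_sub _).2, and_left_comm]

theorem length_dual (S : ABS T) : S.dual.length = S.length := by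
  let := S.ord
  rw [length_eq_zeroOneCount S id (fun _ _ => le_of_lt) (fun _ _ => congrArg _),
    length_eq_zeroOneCount S.dual OrderDual.toDual
      (fun s t (h : OrderDual.toDual s < OrderDual.toDual t) => h.le)
      (fun s t h => congrArg _ (OrderDual.toDual.injective h))]
  exact zeroOneCount_of_antitone (Equiv.refl T) (fun _ => rfl) fun _ _ => Iff.rfl

omit [Fintype T] [Fintype U] in
theorem binExp_lt_binExp_dual_iff (e : T ≃ U) (hδ : ∀ t, δ' (e t) = 1 - δ t)
    (hπ : Function.Semiconj e π π') (s t : T) :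
    binExp δ' π' (e s) < binExp δ' π' (e t) ↔ binExp δ π t < binExp δ π s := by
  have hdigit (u : T) (k : ℕ) : binExp δ' π' (e u) k = 1 - binExp δ π u k := by
    have hinv : Function.Semiconj e ⇑π⁻¹ ⇑π'⁻¹ :=
      hπ.inverses_right π.right_inv π'.left_inv
    have hpow := (hinv.iterate_right (k + 1)).eq u
    simp only [← Equiv.Perm.coe_pow] at hpow
    change δ' ((π'⁻¹ ^ (k + 1)) (e u)) = 1 - δ ((π⁻¹ ^ (k + 1)) u)
    rw [← hpow, hδ]
  have hlt (a b : Fin 2) : 1 - a < 1 - b ↔ b < a := by omega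
  have heq (a b : Fin 2) : 1 - a = 1 - b ↔ b = a := by omega
  change (∃ k, (∀ l < k, binExp δ' π' (e s) l = binExp δ' π' (e t) l) ∧
      binExp δ' π' (e s) k < binExp δ' π' (e t) k) ↔
    ∃ k, (∀ l < k, binExp δ π t l = binExp δ π s l) ∧ binExp δ π t k < binExp δ π s k
  simp only [hdigit, hlt, heq]

theorem zeroOneCount_binExp_dual (e : T ≃ U) (hδ : ∀ t, δ' (e t) = 1 - δ t)
    (hπ : Function.Semiconj e π π') :
    zeroOneCount δ' (binExp δ' π') = zeroOneCount δ (binExp δ π) :=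
  zeroOneCount_of_antitone e hδ (binExp_lt_binExp_dual_iff e hδ hπ)

variable (m n m₁ n₁ m₂ n₂ : ℕ)

/-- The bijection from `N_{m,n}` to `N_{n,m}` which reverses the order; it identifies the dual of
`N_{m,n}` with `N_{n,m}`. -/
def simpleDual : Fin (m + n) ≃ Fin (n + m) :=
  Fin.revPerm.trans (finCongr (Nat.add_comm m n))

theorem simpleDual_val (k : Fin (m + n)) : (simpleDual m n k : ℕ) = m + n - (k + 1) := by
  simp [simpleDual]

theorem simpleDual_δ (k : Fin (m + n)) :
    (simple n m).δ (simpleDual m n k) = 1 - (simple m n).δ k := by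
  have hk := k.2
  rw [simple_δ, simple_δ, simpleDual_val]
  split_ifs <;> omega

theorem semiconj_simpleDual :
    Function.Semiconj (simpleDual m n) (simple m n).π (simple n m).π := fun k => by
  refine Fin.ext ?_
  rw [simple_π_val, simpleDual_val, simpleDual_val, simple_π_val]
  grind

/-- The bijection from `A ⊕ B` to `B_D ⊕ A_D` which is order-reversing on `A` and on `B`. -/
def twoSegmentDual : Fin (m₁ + n₁) ⊕ Fin (m₂ + n₂) ≃ Fin (n₂ + m₂) ⊕ Fin (n₁ + m₁) :=
  (Equiv.sumComm _ _).trans (Equiv.sumCongr (simpleDual m₂ n₂) (simpleDual m₁ n₁))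

theorem twoSegmentDual_δ (t : Fin (m₁ + n₁) ⊕ Fin (m₂ + n₂)) :
    (twoSegment n₂ m₂ n₁ m₁).δ (twoSegmentDual m₁ n₁ m₂ n₂ t) =
      1 - (twoSegment m₁ n₁ m₂ n₂).δ t :=
  t.rec (simpleDual_δ m₁ n₁) (simpleDual_δ m₂ n₂)

theorem semiconj_twoSegmentDual :
    Function.Semiconj (twoSegmentDual m₁ n₁ m₂ n₂) (twoSegment m₁ n₁ m₂ n₂).π
      (twoSegment n₂ m₂ n₁ m₁).π
  | .inl k => congrArg Sum.inr (semiconj_simpleDual m₁ n₁ k)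
  | .inr k => congrArg Sum.inl (semiconj_simpleDual m₂ n₂ k)

theorem length_twoSegment :
    (twoSegment m₁ n₁ m₂ n₂).length =
      zeroOneCount (twoSegment m₁ n₁ m₂ n₂).δ
        (binExp (twoSegment m₁ n₁ m₂ n₂).δ (twoSegment m₁ n₁ m₂ n₂).π) :=
  length_eq_zeroOneCount _ _ (fun _ _ => sortBy_le _ _) (fun _ _ => δ_eq_of_binExp_eq _ _ _ _)

theorem length_twoSegment_dual :
    (twoSegment n₂ m₂ n₁ m₁).length = (twoSegment m₁ n₁ m₂ n₂).length := by
  rw [length_twoSegment, length_twoSegment]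
  exact zeroOneCount_binExp_dual _ (twoSegmentDual_δ m₁ n₁ m₂ n₂)
    (semiconj_twoSegmentDual m₁ n₁ m₂ n₂)

omit [Fintype T] [Fintype U] in
theorem semiconj_smallMod [DecidableEq T] [DecidableEq U] {e : T ≃ U}
    (hπ : Function.Semiconj e π π') (x y : T) :
    Function.Semiconj e (smallMod π x y) (smallMod π' (e y) (e x)) := fun t => by
  rw [smallMod, smallMod, Equiv.trans_apply, Equiv.trans_apply, ← hπ.eq, Equiv.swap_comm]
  exact e.injective.map_swap _ _ _

theorem length_spec_twoSegmentDual (x y : Fin (m₁ + n₁) ⊕ Fin (m₂ + n₂)) :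
    ((twoSegment n₂ m₂ n₁ m₁).spec (twoSegmentDual m₁ n₁ m₂ n₂ y)
      (twoSegmentDual m₁ n₁ m₂ n₂ x)).length = ((twoSegment m₁ n₁ m₂ n₂).spec x y).length := by
  rw [length_spec, length_spec]
  exact zeroOneCount_binExp_dual _ (twoSegmentDual_δ m₁ n₁ m₂ n₂)
    (semiconj_smallMod (semiconj_twoSegmentDual m₁ n₁ m₂ n₂) x y)

variable {m n m₁ n₁ m₂ n₂} {i j : ℕ}

theorem twoSegmentDual_symA (hi : 1 ≤ i ∧ i ≤ m₁ + n₁)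
    (hi' : 1 ≤ m₁ + n₁ - i + 1 ∧ m₁ + n₁ - i + 1 ≤ n₁ + m₁) :
    twoSegmentDual m₁ n₁ m₂ n₂ (symA i hi) = symB (m₁ + n₁ - i + 1) hi' :=
  congrArg Sum.inr (Fin.ext (by rw [simpleDual_val]; dsimp only; omega))

theorem twoSegmentDual_symB (hj : 1 ≤ j ∧ j ≤ m₂ + n₂)
    (hj' : 1 ≤ m₂ + n₂ - j + 1 ∧ m₂ + n₂ - j + 1 ≤ n₂ + m₂) :
    twoSegmentDual m₁ n₁ m₂ n₂ (symB j hj) = symA (m₂ + n₂ - j + 1) hj' :=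
  congrArg Sum.inl (Fin.ext (by rw [simpleDual_val]; dsimp only; omega))

end Dual

section Slope

variable {m n : ℕ}

theorem lt_of_half_lt_slope (h : (1 : ℚ) / 2 < n / (m + n)) : m < n := by
  by_contra! hnm
  have hnm : (n : ℚ) ≤ m := by exact_mod_cast hnm
  exact h.not_ge (div_le_of_le_mul₀ (by positivity) (by norm_num) (by linarith))

theorem lt_of_slope_lt_half (hc : m.Coprime n) (h : (n : ℚ) / (m + n) < 1 / 2) : n < m := by
  have hpos : (0 : ℚ) < m + n := by
    norm_cast
    refine Nat.pos_of_ne_zero fun h0 => ?_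
    obtain ⟨rfl, rfl⟩ := Nat.add_eq_zero_iff.1 h0
    simp at hc
  rw [div_lt_div_iff₀ hpos two_pos] at h
  exact_mod_cast (by linarith : (n : ℚ) < m)

end Slope

section Exchange

variable {m₁ n₁ m₂ n₂ : ℕ} {i : Fin (m₁ + n₁)} {j : Fin (m₂ + n₂)}

theorem length_spec_inl_inr (h₁ : m₁ < n₁) (h₂ : n₂ < m₂) (hi : m₁ ≤ (i : ℕ) ∧ (i : ℕ) < n₁)
    (hj : (j : ℕ) < m₂) :
    (((twoSegment m₁ n₁ m₂ n₂).spec (.inl i) (.inr j)).length : ℤ) ≤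
        (twoSegment m₁ n₁ m₂ n₂).length - 1 ∧
      ((((twoSegment m₁ n₁ m₂ n₂).spec (.inl i) (.inr j)).length : ℤ) =
          (twoSegment m₁ n₁ m₂ n₂).length - 1 ↔
        IsGood (pos m₁ n₁ m₂ n₂) (twoSegment m₁ n₁ m₂ n₂).δ (twoSegment m₁ n₁ m₂ n₂).π
          (.inl i) (.inr j)) := by
  have hpos : pos m₁ n₁ m₂ n₂ (.inl i) < pos m₁ n₁ m₂ n₂ (.inr j) := by
    rw [pos_inl, pos_inr]; grind
  obtain ⟨hle, hiff⟩ := length_spec_twoSegment h₁ h₂ hpos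
    (by rw [twoSegment_δ_inl]; grind) (by rw [twoSegment_δ_inr]; grind)
  rw [← hiff]
  omega

end Exchange

end ABS

theorem proposition4p3 (m₁ n₁ m₂ n₂ : ℕ)
    (hc₁ : Nat.Coprime m₁ n₁) (hc₂ : Nat.Coprime m₂ n₂)
    (hl₂ : (n₂ : ℚ) / (m₂ + n₂) < 1 / 2) (hl₁ : (1 : ℚ) / 2 < n₁ / (m₁ + n₁)) :
    -- (i)
    (∀ (i j : ℕ) (hi : m₁ < i ∧ i ≤ n₁) (hj : 1 ≤ j ∧ j ≤ n₂),
      ((((ABS.twoSegment m₁ n₁ m₂ n₂).spec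
          (ABS.symA i (by omega)) (ABS.symB j (by omega))).length : ℤ)
          = (ABS.twoSegment m₁ n₁ m₂ n₂).length - 1) ↔
        ¬ ∃ n : ℕ,
          ABS.symA (i + m₁) (by omega) ∈ ABS.calA m₁ n₁ m₂ n₂
            (ABS.symA i (by omega)) (ABS.symB j (by omega)) n ∨
          ABS.symB (j + m₂) (by omega) ∈ ABS.calB m₁ n₁ m₂ n₂
            (ABS.symA i (by omega)) (ABS.symB j (by omega)) n) ∧
    -- (ii)
    (0 < m₁ ∨ 0 < n₂ →
      ∀ (i j : ℕ) (hi : m₁ < i ∧ i ≤ n₁) (hj : n₂ < j ∧ j ≤ m₂),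
        (((ABS.twoSegment m₁ n₁ m₂ n₂).spec
          (ABS.symA i (by omega)) (ABS.symB j (by omega))).length : ℤ)
          < (ABS.twoSegment m₁ n₁ m₂ n₂).length - 1) ∧
    -- (iii), for the dual ABS's and for the dual exchange in the ABS of the dual polygon
    (∀ (i j : ℕ) (hi : n₁ < i ∧ i ≤ m₁ + n₁) (hj : n₂ < j ∧ j ≤ m₂),
      (((((ABS.twoSegment m₁ n₁ m₂ n₂).spec
          (ABS.symA i (by omega)) (ABS.symB j (by omega))).length : ℤ)
          = (ABS.twoSegment m₁ n₁ m₂ n₂).length - 1) ↔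
        ((((ABS.twoSegment m₁ n₁ m₂ n₂).spec
          (ABS.symA i (by omega)) (ABS.symB j (by omega))).dual.length : ℤ)
          = (ABS.twoSegment m₁ n₁ m₂ n₂).dual.length - 1)) ∧
      (((((ABS.twoSegment m₁ n₁ m₂ n₂).spec
          (ABS.symA i (by omega)) (ABS.symB j (by omega))).length : ℤ)
          = (ABS.twoSegment m₁ n₁ m₂ n₂).length - 1) ↔
        ((((ABS.twoSegment n₂ m₂ n₁ m₁).spec
          (ABS.symA (m₂ + n₂ - j + 1) (by omega)) (ABS.symB (m₁ + n₁ - i + 1) (by omega))).length : ℤ)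
          = (ABS.twoSegment n₂ m₂ n₁ m₁).length - 1))) := by
  have h₁ := ABS.lt_of_half_lt_slope hl₁
  have h₂ := ABS.lt_of_slope_lt_half hc₂ hl₂
  refine ⟨fun i j hi hj => ?_, fun hpos i j hi hj => ?_, fun i j hi hj => ⟨?_, ?_⟩⟩
  · have hi' : m₁ ≤ i - 1 ∧ i - 1 < n₁ := by omega
    have hj' : j - 1 < n₂ := by omega
    exact (ABS.length_spec_inl_inr h₁ h₂ hi' (hj'.trans h₂)).2.trans <|
      ABS.isGood_iff_notMem hc₁ hc₂ h₁ h₂ hi' hj'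
        (Fin.ext (by rw [ABS.simple_π_val]; grind)) (Fin.ext (by rw [ABS.simple_π_val]; grind))
  · have hi' : m₁ ≤ i - 1 ∧ i - 1 < n₁ := by omega
    have hj' : n₂ ≤ j - 1 ∧ j - 1 < m₂ := by omega
    obtain ⟨hle, hiff⟩ := ABS.length_spec_inl_inr (i := ⟨i - 1, by omega⟩)
      (j := ⟨j - 1, by omega⟩) h₁ h₂ hi' hj'.2
    exact hle.lt_of_ne fun h => ABS.not_isGood_of_le h₁ h₂ hpos hi' hj' (hiff.1 h)
  · rw [ABS.length_dual, ABS.length_dual]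
  · rw [← ABS.twoSegmentDual_symA ⟨by omega, by omega⟩,
      ← ABS.twoSegmentDual_symB ⟨by omega, by omega⟩, ABS.length_spec_twoSegmentDual,
      ABS.length_twoSegment_dual]
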